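/- Let $\mathbb L$ be the space of (affine) lines in $\mathbb R^3$, with its Borel $\sigma$-algebra, and let $\mu$ be a non-trivial measure on $\mathbb L$ that is invariant under translations and rotations; non-trivial means that $\mu\neq 0$ and that for every ball the set of lines meeting it has finite $\mu$-measure. For $u>0$, the Poisson cylinder model with intensity $u$ is a Poisson point process $\omega$ on $\mathbb L$ with intensity measure $u\mu$; each line $l$ of $\omega$ is the axis of the closed cylinder $C(l)=\{x\in\mathbb R^3 : \operatorname{dist}(x,l)\le 1\}$. For $(z,R,V)\in S=\mathbb R^2\times[1,\infty)\times(-\pi/2,\pi/2]$ let $E(z,R,V)\subset\mathbb R^2$ be the filled ellipse with center $z$, major semi-axis of length $R$ in the direction $(\cos V,\sin V)$, and minor semi-axis of length $1$. For $u'>0$ and a probability measure $\rho$ on $[1,\infty)$ such that $\rho[r,\infty)\asymp r^{-\alpha}$ for $r\ge 1$, for some $\alpha>0$, the $(u',\rho)$-ellipses model is a Poisson point process $\xi$ on $S$ with intensity measure $(u'\lambda)\otimes\rho\otimes\nu$, where $\lambda$ is the Lebesgue measure on $\mathbb R^2$ and $\nu$ is the uniform distribution on $(-\pi/2,\pi/2]$.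 **Proposition.** The Poisson cylinder model in $\mathbb R^3$, restricted to a plane, is an ellipses model with $\rho(r,\infty)=r^{-2}$ for $r\ge 1$. Precisely: there is a probability measure $\rho$ on $[1,\infty)$ with $\rho(r,\infty)=r^{-2}$ for all $r\ge 1$, such that for every $\mu$ as above there is a constant $c=c(\mu)>0$ for which the following holds. For every isometric parametrization $\iota:\mathbb R^2\to\mathbb R^3$ of a plane, there is a measurable map $T:\mathbb L\to S$ such that $\iota^{-1}(C(l))=E(T(l))$ for every line $l$ that is not parallel to the plane $\iota(\mathbb R^2)$ (a line contained in the plane counts as parallel to it), and for every $u>0$ and every Poisson cylinder model $\omega$ with intensity measure $u\mu$, the image $\xi=T_*\omega$ is a $(cu,\rho)$-ellipses model, and almost surely $$\iota^{-1}(C(l))=E(T(l))\ \text{ for every line } l \text{ of } \omega,\qquad \iota^{-1}\Big(\bigcup_{l\in\operatorname{supp}\omega}C(l)\Big)=\bigcup_{s\in\operatorname{supp}\xi}E(s).$$ -/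

import Mathlib

open MeasureTheory ProbabilityTheory
open scoped ENNReal

namespace PoissonEllipses

/-! ### Poisson point processes -/

section PointProcess

variable {X : Type*} [MeasurableSpace X]

/-- A (countable) point measure `∑ i, δ_{x i}`. -/
def IsPointMeasure (m : Measure X) : Prop :=
  ∃ (I : Type) (_ : Countable I) (x : I → X), m = Measure.sum (fun i => Measure.dirac (x i))

/-- The points of a point measure, i.e. its support when the points are locally finite. -/
def points (m : Measure X) : Set X := {x | m {x} ≠ 0}

/-- `N` is a Poisson point process on `X` with intensity measure `Λ`, under the law `P`. -/
structure IsPoissonProcess {Ω : Type*} [MeasurableSpace Ω] (P : Measure Ω)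
    (N : Ω → Measure X) (Λ : Measure X) : Prop where
  /-- the number of points in a measurable set is a random variable -/
  measurable_count : ∀ A, MeasurableSet A → Measurable (fun ω => N ω A)
  isPointMeasure : ∀ᵐ ω ∂P, IsPointMeasure (N ω)
  /-- the number of points in a set of finite intensity is a Poisson variable -/
  law_count : ∀ A, MeasurableSet A → Λ A ≠ ∞ →
    P.map (fun ω => N ω A) = (poissonMeasure (Λ A).toNNReal).map (fun k : ℕ => (k : ℝ≥0∞))
  /-- a set of infinite intensity contains infinitely many points -/
  count_eq_top : ∀ A, MeasurableSet A → Λ A = ∞ → ∀ᵐ ω ∂P, N ω A = ∞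
  /-- the numbers of points in disjoint sets are independent -/
  indep : ∀ (n : ℕ) (A : Fin n → Set X), (∀ i, MeasurableSet (A i)) →
    Pairwise (fun i j => Disjoint (A i) (A j)) → iIndepFun (fun i ω => N ω (A i)) P

end PointProcess

/-- The Euclidean plane. -/
abbrev E2 := EuclideanSpace ℝ (Fin 2)

/-- The Euclidean 3-space. -/
abbrev E3 := EuclideanSpace ℝ (Fin 3)

/-! ### The ellipses model -/

/-- The parameter space `ℝ² × [1, ∞) × (-π/2, π/2]` of ellipses: center, size of the major
(semi-)axis, direction of the major axis. -/
abbrev EllipseParam := E2 × (Set.Ici (1 : ℝ) × Set.Ioc (-(Real.pi / 2)) (Real.pi / 2))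

/-- The filled ellipse with center `z`, major semi-axis `R` in the direction
`(cos V, sin V)` and minor semi-axis `1`. -/
def ellipse (s : EllipseParam) : Set E2 :=
  let z : E2 := s.1
  let R : ℝ := s.2.1
  let V : ℝ := s.2.2
  {x | (((x 0 - z 0) * Real.cos V + (x 1 - z 1) * Real.sin V) / R) ^ 2
    + (-(x 0 - z 0) * Real.sin V + (x 1 - z 1) * Real.cos V) ^ 2 ≤ 1}

/-- The uniform distribution on the directions `(-π/2, π/2]`. -/
noncomputable def uniformDirection : Measure (Set.Ioc (-(Real.pi / 2)) (Real.pi / 2)) :=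
  (ENNReal.ofReal Real.pi)⁻¹ • (volume : Measure ℝ).comap Subtype.val

/-- The measure `(u λ) ⊗ ρ ⊗ ν` on the parameter space of ellipses. -/
noncomputable def ellipsesIntensity (u : ℝ) (ρ : Measure (Set.Ici (1 : ℝ))) :
    Measure EllipseParam :=
  (ENNReal.ofReal u • (volume : Measure E2)).prod (ρ.prod uniformDirection)

/-- `ρ[r, ∞) ≍ r ^ (-α)` for `r ≥ 1`. -/
def HasTailDecay (ρ : Measure (Set.Ici (1 : ℝ))) (α : ℝ) : Prop :=
  ∃ C : ℝ, 0 < C ∧ ∀ r : ℝ, 1 ≤ r →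
    C⁻¹ * r ^ (-α) ≤ ρ.real {R | r ≤ (R : ℝ)} ∧ ρ.real {R | r ≤ (R : ℝ)} ≤ C * r ^ (-α)

/-- `ξ` is a `(u, ρ)`-ellipses model under the law `P`. -/
structure IsEllipsesModel {Ω : Type*} [MeasurableSpace Ω] (P : Measure Ω)
    (ξ : Ω → Measure EllipseParam) (u : ℝ) (ρ : Measure (Set.Ici (1 : ℝ))) : Prop where
  intensity_pos : 0 < u
  isProbabilityMeasure : IsProbabilityMeasure ρ
  tailDecay : ∃ α : ℝ, 0 < α ∧ HasTailDecay ρ α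
  isPoissonProcess : IsPoissonProcess P ξ (ellipsesIntensity u ρ)

/-- The set covered by the ellipses of a point measure. -/
def ellipsesCoveredSet (m : Measure EllipseParam) : Set E2 := ⋃ s ∈ points m, ellipse s

/-! ### The Poisson cylinder model in dimension 3 -/

/-- A line in `ℝ³`. -/
@[ext]
structure Line where
  /-- the set of points of the line -/
  carrier : AffineSubspace ℝ E3
  finrank_direction : Module.finrank ℝ carrier.direction = 1

namespace Line

/-- The line through `p` with direction `w`. -/
noncomputable def ofPointDir (p : E3) (w : Metric.sphere (0 : E3) 1) : Line where
  carrier := AffineSubspace.mk' p (Submodule.span ℝ {(w : E3)})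
  finrank_direction := by
    rw [AffineSubspace.direction_mk']
    exact finrank_span_singleton (ne_zero_of_mem_unit_sphere w)

/-- The Borel structure of the space of lines, as a quotient of `ℝ³ × S²`: a set of lines is
measurable iff the set of all `(p, w)` that span a line of the set is Borel. -/
noncomputable instance : MeasurableSpace Line :=
  MeasurableSpace.map (fun q : E3 × Metric.sphere (0 : E3) 1 => ofPointDir q.1 q.2) inferInstance

/-- The image of a line under an isometry of `ℝ³`. -/
noncomputable def map (f : E3 ≃ᵃⁱ[ℝ] E3) (l : Line) : Line where
  carrier := l.carrier.map f.toAffineEquiv.toAffineMap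
  finrank_direction := by
    rw [AffineSubspace.map_direction]
    exact (LinearEquiv.finrank_map_eq f.linearIsometryEquiv.toLinearEquiv _).trans
      l.finrank_direction

/-- The closed cylinder of radius `1` with axis `l`. -/
def cylinder (l : Line) : Set E3 := {x | ∃ y ∈ l.carrier, dist x y ≤ 1}

end Line

/-- A non-trivial (nonzero, and finite on the set of lines that meet a given ball) measure on
the space of lines that is invariant under translations and rotations. -/
structure IsInvariantLineMeasure (μ : Measure Line) : Prop where
  ne_zero : μ ≠ 0
  locallyFinite : ∀ r : ℝ, μ {l | ∃ x ∈ l.carrier, ‖x‖ ≤ r} < ∞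
  translation : ∀ (v : E3) (A : Set Line), MeasurableSet A →
    μ (Line.map (AffineIsometryEquiv.constVAdd ℝ E3 v) ⁻¹' A) = μ A
  rotation : ∀ g : E3 ≃ₗᵢ[ℝ] E3, LinearMap.det (g.toLinearEquiv : E3 →ₗ[ℝ] E3) = 1 →
    ∀ A : Set Line, MeasurableSet A → μ (Line.map g.toAffineIsometryEquiv ⁻¹' A) = μ A

/-- `N` is a Poisson cylinder model (given by the axes of the cylinders) of intensity `u`,
where `μ` is the chosen normalization of the invariant measure on lines. -/
structure IsCylinderModel {Ω : Type*} [MeasurableSpace Ω] (P : Measure Ω)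
    (N : Ω → Measure Line) (u : ℝ) (μ : Measure Line) : Prop where
  intensity_pos : 0 < u
  isInvariant : IsInvariantLineMeasure μ
  isPoissonProcess : IsPoissonProcess P N (ENNReal.ofReal u • μ)

/-- The set covered by the cylinders whose axes are the points of a point measure. -/
def cylindersCoveredSet (m : Measure Line) : Set E3 := ⋃ l ∈ points m, l.cylinder

end PoissonEllipses

open PoissonEllipses

namespace PoissonEllipses

/-! ### Isometries of the 3-space -/

section Isometries

/-! A measurable image of a Poisson process is a Poisson process with the image intensity
(`IsPoissonProcess.map`), so the theorem reduces to computing the image of `μ` under the map sending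
a line to its ellipse. A rotation and a translation, both of which preserve `μ`, reduce an arbitrary
plane to the horizontal one.

A non-horizontal line is given by its trace on the plane and its slope `a ∈ ℝ²`. Its cylinder cuts
the plane in the ellipse centred at the trace, with major semi-axis `R = √(1 + ‖a‖²) = 1 / |cos φ|`
in the direction of `a`, where `φ` is the angle between the line and the vertical
(`mem_cylinder_iff_mem_ellipse`). Horizontal lines form a null set (`measure_horizontalLines`).

Invariance under horizontal translations and uniqueness of Haar measure make the law of (trace,
slope) a product `λ ⊗ σ` with `σ` finite (`exists_slope_law`). Rotations about the vertical axis
preserve `σ`, so the direction of `a` modulo `π` is uniform and independent of `R`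
(`map_slopeSize_slopeAngle`).

The law of `R` needs all rotations, but no classification of the invariant measures. Restricted to
the lines at distance at most `1` from the origin, `μ` is finite and rotation invariant. Averaging a
function of `‖v‖` and `⟨v, w⟩²` over vectors `v` and such lines of direction `w`, in both orders,
shows that the integral of `|cos φ|` over `{|cos φ| ≤ t}` is proportional to `t²`
(`near_mul_lintegral`, `lintegral_near_zone`). On the other hand, a line is near the origin iff its
ellipse contains the origin, and the centres for which this happens fill an area `πR`. The weight
`|cos φ| = 1/R` cancels this factor, leaving `σ(R ≥ r)` proportional to `r⁻²` (`map_slopeSize`). -/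

lemma E3.inner_eq (v w : E3) : inner ℝ v w = v 0 * w 0 + v 1 * w 1 + v 2 * w 2 := by
  rw [PiLp.inner_apply, Fin.sum_univ_three]
  simp [mul_comm]

lemma E3.norm_sq_eq (v : E3) : ‖v‖ ^ 2 = v 0 ^ 2 + v 1 ^ 2 + v 2 ^ 2 := by
  rw [EuclideanSpace.real_norm_sq_eq, Fin.sum_univ_three]

lemma E2.norm_sq_eq (v : E2) : ‖v‖ ^ 2 = v 0 ^ 2 + v 1 ^ 2 := by
  rw [EuclideanSpace.real_norm_sq_eq, Fin.sum_univ_two]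

/-- The `i`-th vector of the standard basis of `ℝ³`. -/
noncomputable abbrev E3.basisVec (i : Fin 3) : E3 := EuclideanSpace.single i 1

lemma E3.norm_sq_of_mem_sphere (w : Metric.sphere (0 : E3) 1) :
    (w : E3) 0 ^ 2 + (w : E3) 1 ^ 2 + (w : E3) 2 ^ 2 = 1 := by
  rw [← E3.norm_sq_eq, norm_eq_of_mem_sphere w, one_pow]

/-- The inclusion of the plane as the horizontal coordinate plane. -/
noncomputable def horizontal : E2 →ₗᵢ[ℝ] E3 where
  toFun x := !₂[x 0, x 1, 0]
  map_add' x y := by ext i; fin_cases i <;> simp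
  map_smul' c x := by ext i; fin_cases i <;> simp
  norm_map' x := by
    rw [← sq_eq_sq₀ (norm_nonneg _) (norm_nonneg _), E2.norm_sq_eq, E3.norm_sq_eq]
    simp

lemma horizontal_apply (x : E2) : horizontal x = !₂[x 0, x 1, 0] := rfl

@[simp] lemma horizontal_apply_zero (x : E2) : horizontal x 0 = x 0 := rfl
@[simp] lemma horizontal_apply_one (x : E2) : horizontal x 1 = x 1 := rfl
@[simp] lemma horizontal_apply_two (x : E2) : horizontal x 2 = 0 := rfl

lemma mem_range_horizontal {v : E3} (hv : v 2 = 0) : v ∈ Set.range horizontal := by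
  refine ⟨!₂[v 0, v 1], ?_⟩
  ext i; fin_cases i <;> simp [horizontal_apply, hv]

/-- A linear map scales volumes by the absolute value of its determinant, whereas an isometry
preserves the positive finite volume of the unit ball. -/
lemma abs_det_linearIsometryEquiv (g : E3 ≃ₗᵢ[ℝ] E3) :
    |LinearMap.det (g.toLinearEquiv : E3 →ₗ[ℝ] E3)| = 1 := by
  have h0 : LinearMap.det (g.toLinearEquiv : E3 →ₗ[ℝ] E3) ≠ 0 :=
    (LinearEquiv.isUnit_det' g.toLinearEquiv).ne_zero
  have h1 := Measure.addHaar_preimage_linearMap (volume : Measure E3) h0 (Metric.ball 0 1)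
  have h2 := g.measurePreserving.measure_preimage
    (s := Metric.ball (0 : E3) 1) measurableSet_ball.nullMeasurableSet
  have h3 : (volume : Measure E3) (Metric.ball 0 1) ≠ 0 :=
    (Metric.measure_ball_pos _ _ one_pos).ne'
  have h4 : (volume : Measure E3) (Metric.ball 0 1) ≠ ∞ := measure_ball_lt_top.ne
  have h5 : ((g.toLinearEquiv : E3 →ₗ[ℝ] E3) : E3 → E3) = g := rfl
  rw [h5, h2] at h1
  have h6 := (ENNReal.mul_eq_right h3 h4).1 h1.symm
  rw [ENNReal.ofReal_eq_one, abs_inv, inv_eq_one] at h6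
  exact h6

/-- An isometry can be made a rotation without changing it on a hyperplane. -/
lemma exists_rotation_eqOn (g : E3 ≃ₗᵢ[ℝ] E3) (n : E3) (hn : n ≠ 0) :
    ∃ g' : E3 ≃ₗᵢ[ℝ] E3, LinearMap.det (g'.toLinearEquiv : E3 →ₗ[ℝ] E3) = 1 ∧
      ∀ v : E3, inner ℝ n v = 0 → g' v = g v := by
  rcases (abs_eq zero_le_one).1 (abs_det_linearIsometryEquiv g) with h | h
  · exact ⟨g, h, fun _ _ => rfl⟩
  -- The reflection in the hyperplane orthogonal to `n` fixes that hyperplane and has determinant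
  -- `-1`.
  refine ⟨((ℝ ∙ n)ᗮ.reflection).trans g, ?_, fun v hv => ?_⟩
  · have h1 := Submodule.det_reflection (ℝ ∙ n)ᗮ
    rw [Submodule.orthogonal_orthogonal, finrank_span_singleton hn, pow_one] at h1
    have h2 : ((((ℝ ∙ n)ᗮ.reflection).trans g).toLinearEquiv : E3 →ₗ[ℝ] E3)
        = (g.toLinearEquiv : E3 →ₗ[ℝ] E3) ∘ₗ
          ((ℝ ∙ n)ᗮ.reflection.toLinearEquiv : E3 →ₗ[ℝ] E3) := rfl
    rw [h2, LinearMap.det_comp, h, h1]; norm_num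
  · have : (ℝ ∙ n)ᗮ.reflection v = v :=
      Submodule.reflection_mem_subspace_eq_self (Submodule.mem_orthogonal_singleton_iff_inner_right.2 hv)
    change g ((ℝ ∙ n)ᗮ.reflection v) = g v
    rw [this]

/-- The reflection exchanging the vertical unit vector and `u` is corrected to a rotation along the
first basis vector, which is orthogonal to the vertical one. -/
lemma exists_rotation_apply_eq (u : E3) (hu : ‖u‖ = 1) :
    ∃ g : E3 ≃ₗᵢ[ℝ] E3, LinearMap.det (g.toLinearEquiv : E3 →ₗ[ℝ] E3) = 1 ∧
      g (E3.basisVec 2) = u := by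
  obtain ⟨g, hg, h⟩ := exists_rotation_eqOn ((ℝ ∙ (E3.basisVec 2 - u))ᗮ.reflection)
    (E3.basisVec 0) (by simp)
  refine ⟨g, hg, ?_⟩
  rw [h (E3.basisVec 2) (by rw [E3.inner_eq]; simp), Submodule.reflection_sub]
  simp [hu]

lemma exists_rotation_comp_horizontal (L : E2 →ₗᵢ[ℝ] E3) :
    ∃ g : E3 ≃ₗᵢ[ℝ] E3, LinearMap.det (g.toLinearEquiv : E3 →ₗ[ℝ] E3) = 1 ∧
      ∀ x, g (horizontal x) = L x := by
  let K : LinearMap.range horizontal.toLinearMap →ₗᵢ[ℝ] E3 :=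
    L.comp horizontal.equivRange.symm.toLinearIsometry
  obtain ⟨g, hg, h⟩ := exists_rotation_eqOn (K.extend.toLinearIsometryEquiv rfl)
    (E3.basisVec 2) (by simp)
  refine ⟨g, hg, fun x => ?_⟩
  rw [h _ (by rw [E3.inner_eq]; simp)]
  have h2 := K.extend_apply (horizontal.equivRange x)
  have h3 : K (horizontal.equivRange x) = L x := by
    change L (horizontal.equivRange.symm (horizontal.equivRange x)) = L x
    rw [LinearIsometryEquiv.symm_apply_apply]
  rw [h3] at h2
  exact h2

/-- The rotation of the plane by the angle `θ`. -/
noncomputable def planeRotation (θ : ℝ) (x : E2) : E2 :=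
  !₂[Real.cos θ * x 0 - Real.sin θ * x 1, Real.sin θ * x 0 + Real.cos θ * x 1]

/-- The rotation of `ℝ³` by the angle `θ` about the vertical axis. -/
lemma exists_rotation_vertical (θ : ℝ) :
    ∃ g : E3 ≃ₗᵢ[ℝ] E3, LinearMap.det (g.toLinearEquiv : E3 →ₗ[ℝ] E3) = 1 ∧
      ∀ x, g x = !₂[Real.cos θ * x 0 - Real.sin θ * x 1,
        Real.sin θ * x 0 + Real.cos θ * x 1, x 2] := by
  let M : Matrix (Fin 3) (Fin 3) ℝ :=
    !![Real.cos θ, -Real.sin θ, 0; Real.sin θ, Real.cos θ, 0; 0, 0, 1]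
  have hM : ∀ x, Matrix.toEuclideanLin M x = !₂[Real.cos θ * x 0 - Real.sin θ * x 1,
        Real.sin θ * x 0 + Real.cos θ * x 1, x 2] := by
    intro x
    ext i
    fin_cases i <;> simp [M, Matrix.toLpLin_apply, dotProduct, Fin.sum_univ_three]; ring
  let L : E3 →ₗᵢ[ℝ] E3 :=
    { Matrix.toEuclideanLin M with
      norm_map' := fun x => by
        change ‖Matrix.toEuclideanLin M x‖ = ‖x‖
        rw [← sq_eq_sq₀ (norm_nonneg _) (norm_nonneg _), E3.norm_sq_eq, E3.norm_sq_eq, hM]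
        simp
        linear_combination (x 0 ^ 2 + x 1 ^ 2) * Real.sin_sq_add_cos_sq θ }
  refine ⟨L.toLinearIsometryEquiv rfl, ?_, fun x => hM x⟩
  have h1 : ((L.toLinearIsometryEquiv rfl).toLinearEquiv : E3 →ₗ[ℝ] E3)
      = Matrix.toEuclideanLin M := by ext x; rfl
  rw [h1, Matrix.toEuclideanLin_eq_toLin_orthonormal, LinearMap.det_toLin]
  simp [M, Matrix.det_fin_three]
  linear_combination Real.sin_sq_add_cos_sq θ

end Isometries

/-! ### Lines -/

namespace Line

lemma mem_ofPointDir {p : E3} {w : Metric.sphere (0 : E3) 1} {y : E3} :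
    y ∈ (ofPointDir p w).carrier ↔ ∃ t : ℝ, y = p + t • (w : E3) := by
  change y ∈ AffineSubspace.mk' p _ ↔ _
  rw [AffineSubspace.mem_mk', Submodule.mem_span_singleton]
  refine exists_congr fun t => ?_
  rw [vsub_eq_sub, eq_sub_iff_add_eq, eq_comm, add_comm]

lemma direction_ofPointDir (p : E3) (w : Metric.sphere (0 : E3) 1) :
    (ofPointDir p w).carrier.direction = Submodule.span ℝ {(w : E3)} :=
  AffineSubspace.direction_mk' _ _

lemma exists_eq_ofPointDir (l : Line) : ∃ p w, l = ofPointDir p w := by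
  have h0 : l.carrier.direction ≠ ⊥ := by
    intro h
    have := l.finrank_direction
    rw [h, finrank_bot] at this
    exact zero_ne_one this
  obtain ⟨v, hv, hv0⟩ := Submodule.exists_mem_ne_zero_of_ne_bot h0
  have hne : (l.carrier : Set E3).Nonempty := by
    rw [AffineSubspace.nonempty_iff_ne_bot]
    intro h
    exact h0 (by rw [h, AffineSubspace.direction_bot])
  obtain ⟨p, hp⟩ := hne
  have hw : ‖(‖v‖⁻¹ • v : E3)‖ = 1 := norm_smul_inv_norm hv0
  refine ⟨p, ⟨‖v‖⁻¹ • v, by simpa using hw⟩, ?_⟩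
  ext1
  have h1 : l.carrier.direction = Submodule.span ℝ {‖v‖⁻¹ • v} := by
    symm
    apply Submodule.eq_of_le_of_finrank_eq
    · rw [Submodule.span_singleton_le_iff_mem]
      exact Submodule.smul_mem _ _ hv
    · rw [l.finrank_direction, finrank_span_singleton]
      intro h
      rw [h, norm_zero] at hw
      exact zero_ne_one hw
  change _ = AffineSubspace.mk' p _
  rw [← h1, AffineSubspace.mk'_eq hp]

/-- A point of a line. -/
noncomputable def pt (l : Line) : E3 := l.exists_eq_ofPointDir.choose

/-- A unit vector that spans the direction of a line. -/
noncomputable def dir (l : Line) : Metric.sphere (0 : E3) 1 :=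
  l.exists_eq_ofPointDir.choose_spec.choose

lemma ofPointDir_pt_dir (l : Line) : ofPointDir l.pt l.dir = l :=
  l.exists_eq_ofPointDir.choose_spec.choose_spec.symm

/-- `dir` and `pt` are arbitrary choices, so a usable function of a line must be even in `dir` and
insensitive to moving `pt` along the line. This lemma and `pt_ofPointDir` are the means to check
that. -/
lemma dir_ofPointDir (p : E3) (w : Metric.sphere (0 : E3) 1) :
    ((ofPointDir p w).dir : E3) = w ∨ ((ofPointDir p w).dir : E3) = -w := by
  have h : ((ofPointDir p w).dir : E3) ∈ Submodule.span ℝ {(w : E3)} := by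
    rw [← direction_ofPointDir p w, ← ofPointDir_pt_dir (ofPointDir p w), direction_ofPointDir,
      ofPointDir_pt_dir]
    exact Submodule.mem_span_singleton_self _
  obtain ⟨t, ht⟩ := Submodule.mem_span_singleton.1 h
  have h2 : |t| = 1 := by
    have := congrArg norm ht
    rwa [norm_smul, norm_eq_of_mem_sphere, norm_eq_of_mem_sphere, mul_one, Real.norm_eq_abs] at this
  rcases (abs_eq zero_le_one).1 h2 with rfl | rfl
  · left; simpa using ht.symm
  · right; simpa using ht.symm

lemma pt_ofPointDir (p : E3) (w : Metric.sphere (0 : E3) 1) :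
    ∃ t : ℝ, (ofPointDir p w).pt = p + t • (w : E3) := by
  rw [← mem_ofPointDir]
  have h : (ofPointDir p w).pt ∈
      (ofPointDir (ofPointDir p w).pt (ofPointDir p w).dir).carrier := mem_ofPointDir.2 ⟨0, by simp⟩
  rwa [ofPointDir_pt_dir] at h

lemma measurable_iff {Y : Type*} [MeasurableSpace Y] {f : Line → Y} :
    Measurable f ↔
      Measurable (fun q : E3 × Metric.sphere (0 : E3) 1 => f (ofPointDir q.1 q.2)) :=
  Iff.rfl

lemma measurable_ofPointDir :
    Measurable (fun q : E3 × Metric.sphere (0 : E3) 1 => ofPointDir q.1 q.2) :=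
  measurable_iff.1 measurable_id

/-- The square of the cosine of the angle of a unit vector and a line. -/
noncomputable def cosSq (v : E3) (l : Line) : ℝ := inner ℝ v (l.dir : E3) ^ 2

lemma cosSq_ofPointDir (v p : E3) (w : Metric.sphere (0 : E3) 1) :
    cosSq v (ofPointDir p w) = inner ℝ v (w : E3) ^ 2 := by
  rcases dir_ofPointDir p w with h | h <;> simp [cosSq, h]

/-- The quotient σ-algebra gives access to functions of the line alone. Joint measurability comes
from expanding the square into products of two coordinates of `dir`, each of which is even and hence
measurable on `Line`. -/
lemma measurable_cosSq : Measurable (fun q : E3 × Line => cosSq q.1 q.2) := by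
  have h : ∀ i j : Fin 3, Measurable (fun l : Line => (l.dir : E3) i * (l.dir : E3) j) := by
    intro i j
    rw [measurable_iff]
    have : (fun q : E3 × Metric.sphere (0 : E3) 1 =>
        ((ofPointDir q.1 q.2).dir : E3) i * ((ofPointDir q.1 q.2).dir : E3) j)
        = fun q => (q.2 : E3) i * (q.2 : E3) j := by
      ext q
      rcases dir_ofPointDir q.1 q.2 with h | h <;> simp [h]
    rw [this]
    fun_prop
  have h2 : (fun q : E3 × Line => cosSq q.1 q.2) = fun q => ∑ i, ∑ j,
      q.1 i * q.1 j * ((q.2.dir : E3) i * (q.2.dir : E3) j) := by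
    ext q
    rw [cosSq, E3.inner_eq]
    simp only [Fin.sum_univ_three]
    ring
  rw [h2]
  refine Finset.measurable_sum _ fun i _ => Finset.measurable_sum _ fun j _ => ?_
  exact (by fun_prop : Measurable fun q : E3 × Line => q.1 i * q.1 j).mul
    ((h i j).comp measurable_snd)

lemma cosSq_smul (c : ℝ) (v : E3) (l : Line) : cosSq (c • v) l = c ^ 2 * cosSq v l := by
  rw [cosSq, cosSq, inner_smul_left]; simp [mul_pow]

/-- The slope of a line: the horizontal displacement along it per unit of height
(and `0` for horizontal lines). -/
noncomputable def slope (l : Line) : E2 :=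
  !₂[(l.dir : E3) 0 / (l.dir : E3) 2, (l.dir : E3) 1 / (l.dir : E3) 2]

/-- The point of intersection of a line with the horizontal coordinate plane
(and `0` for horizontal lines). -/
noncomputable def trace (l : Line) : E2 :=
  !₂[(l.pt 0 * (l.dir : E3) 2 - l.pt 2 * (l.dir : E3) 0) / (l.dir : E3) 2,
    (l.pt 1 * (l.dir : E3) 2 - l.pt 2 * (l.dir : E3) 1) / (l.dir : E3) 2]

lemma slope_ofPointDir (p : E3) (w : Metric.sphere (0 : E3) 1) :
    slope (ofPointDir p w) = !₂[(w : E3) 0 / (w : E3) 2, (w : E3) 1 / (w : E3) 2] := by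
  rcases dir_ofPointDir p w with h | h <;> simp [slope, h, neg_div_neg_eq]

lemma trace_ofPointDir (p : E3) (w : Metric.sphere (0 : E3) 1) :
    trace (ofPointDir p w) = !₂[(p 0 * (w : E3) 2 - p 2 * (w : E3) 0) / (w : E3) 2,
      (p 1 * (w : E3) 2 - p 2 * (w : E3) 1) / (w : E3) 2] := by
  obtain ⟨t, ht⟩ := pt_ofPointDir p w
  rcases dir_ofPointDir p w with h | h
  -- These `2 × 2` determinants do not change when the base point moves along the line; replacing
  -- `w` by `-w` flips their sign together with that of the denominator.
  · have : ∀ i, (p i + t * (w : E3) i) * (w : E3) 2 - (p 2 + t * (w : E3) 2) * (w : E3) i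
        = p i * (w : E3) 2 - p 2 * (w : E3) i := fun i => by ring
    simp [trace, h, ht, this]
  · have : ∀ i, -((p i + t * (w : E3) i) * (w : E3) 2) + (p 2 + t * (w : E3) 2) * (w : E3) i
        = -(p i * (w : E3) 2 - p 2 * (w : E3) i) := fun i => by ring
    simp [trace, h, ht, this]
    constructor <;> rw [div_neg, ← neg_div, neg_sub]

lemma measurable_slope : Measurable slope := by
  rw [measurable_iff]
  simp_rw [slope_ofPointDir]
  refine (MeasurableEquiv.toLp 2 _).measurable.comp (measurable_pi_iff.2 fun i => ?_)
  fin_cases i <;> simp <;> fun_prop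

lemma measurable_trace : Measurable trace := by
  rw [measurable_iff]
  simp_rw [trace_ofPointDir]
  refine (MeasurableEquiv.toLp 2 _).measurable.comp (measurable_pi_iff.2 fun i => ?_)
  fin_cases i <;> simp <;> fun_prop

/-- The image of a unit vector under a linear isometry. -/
noncomputable def mapDir (g : E3 ≃ₗᵢ[ℝ] E3) (w : Metric.sphere (0 : E3) 1) :
    Metric.sphere (0 : E3) 1 := ⟨g w, by simp⟩

lemma map_ofPointDir (f : E3 ≃ᵃⁱ[ℝ] E3) (p : E3) (w : Metric.sphere (0 : E3) 1) :
    map f (ofPointDir p w) = ofPointDir (f p) (mapDir f.linearIsometryEquiv w) := by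
  ext y
  rw [mem_ofPointDir]
  change y ∈ AffineSubspace.map _ _ ↔ _
  rw [AffineSubspace.mem_map]
  constructor
  · rintro ⟨x, hx, rfl⟩
    obtain ⟨t, rfl⟩ := mem_ofPointDir.1 hx
    refine ⟨t, ?_⟩
    have := f.map_vadd p (t • (w : E3))
    rw [vadd_eq_add, vadd_eq_add, map_smul, add_comm] at this
    rw [add_comm (f p)]
    exact this
  · rintro ⟨t, rfl⟩
    refine ⟨p + t • (w : E3), mem_ofPointDir.2 ⟨t, rfl⟩, ?_⟩
    have := f.map_vadd p (t • (w : E3))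
    rw [vadd_eq_add, vadd_eq_add, map_smul, add_comm] at this
    rw [add_comm (f p)]
    exact this

lemma measurable_map (f : E3 ≃ᵃⁱ[ℝ] E3) : Measurable (map f) := by
  rw [measurable_iff]
  simp_rw [map_ofPointDir]
  refine measurable_ofPointDir.comp (f := fun q : E3 × Metric.sphere (0 : E3) 1 =>
    (f q.1, mapDir f.linearIsometryEquiv q.2)) ?_
  refine Measurable.prodMk (f.continuous.measurable.comp measurable_fst) ?_
  refine Measurable.subtype_mk ?_
  exact f.linearIsometryEquiv.continuous.measurable.comp
    (measurable_subtype_coe.comp measurable_snd)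

lemma map_trans (f g : E3 ≃ᵃⁱ[ℝ] E3) (l : Line) : map (f.trans g) l = map g (map f l) := by
  rw [← ofPointDir_pt_dir l]
  simp only [map_ofPointDir]
  rfl

lemma mem_cylinder_map {f : E3 ≃ᵃⁱ[ℝ] E3} {l : Line} {x : E3} :
    f x ∈ (map f l).cylinder ↔ x ∈ l.cylinder := by
  constructor
  · rintro ⟨y, hy, h⟩
    obtain ⟨z, hz, rfl⟩ := (AffineSubspace.mem_map).1 hy
    exact ⟨z, hz, by rw [← f.dist_map]; exact h⟩
  · rintro ⟨z, hz, h⟩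
    exact ⟨f z, (AffineSubspace.mem_map).2 ⟨z, hz, rfl⟩, by rwa [f.dist_map]⟩

/-- Pythagoras: the point of the line closest to `x` has parameter `⟨x - p, w⟩`. -/
lemma mem_cylinder_ofPointDir {p x : E3} {w : Metric.sphere (0 : E3) 1} :
    x ∈ (ofPointDir p w).cylinder ↔ ‖x - p‖ ^ 2 - inner ℝ (x - p) (w : E3) ^ 2 ≤ 1 := by
  have key : ∀ t : ℝ, ‖x - (p + t • (w : E3))‖ ^ 2
      = ‖x - p‖ ^ 2 - inner ℝ (x - p) (w : E3) ^ 2 + (inner ℝ (x - p) (w : E3) - t) ^ 2 := by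
    intro t
    rw [← sub_sub, norm_sub_sq_real, inner_smul_right, norm_smul, norm_eq_of_mem_sphere,
      mul_one, Real.norm_eq_abs, sq_abs]
    ring
  constructor
  · rintro ⟨y, hy, h⟩
    obtain ⟨t, rfl⟩ := mem_ofPointDir.1 hy
    have h1 := pow_le_one₀ (n := 2) dist_nonneg h
    rw [dist_eq_norm, key] at h1
    nlinarith [sq_nonneg (inner ℝ (x - p) (w : E3) - t)]
  · intro h
    refine ⟨_, mem_ofPointDir.2 ⟨inner ℝ (x - p) (w : E3), rfl⟩, ?_⟩
    rw [dist_eq_norm, ← sq_le_one_iff₀ (norm_nonneg _), key]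
    simpa using h

end Line

/-! ### The horizontal section of a cylinder -/

/-- The major semi-axis of the horizontal section of a cylinder, as a function of the slope. -/
noncomputable def slopeSize (a : E2) : Set.Ici (1 : ℝ) :=
  ⟨√(1 + ‖a‖ ^ 2), Real.one_le_sqrt.2 (by nlinarith [sq_nonneg ‖a‖])⟩

/-- A slope as a complex number. -/
noncomputable def slopeComplex (a : E2) : ℂ := ⟨a 0, a 1⟩

/-- The direction modulo `π` of the horizontal section of a cylinder. -/
noncomputable def slopeAngle (a : E2) : Set.Ioc (-(Real.pi / 2)) (Real.pi / 2) :=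
  ⟨Complex.arg (slopeComplex a ^ 2) / 2, by
    constructor
    · linarith [Complex.neg_pi_lt_arg (slopeComplex a ^ 2)]
    · linarith [Complex.arg_le_pi (slopeComplex a ^ 2)]⟩

lemma measurable_slopeSize : Measurable slopeSize := by
  refine Measurable.subtype_mk ?_
  fun_prop

lemma measurable_slopeComplex : Measurable slopeComplex := by
  have : slopeComplex = fun a => Complex.equivRealProdCLM.symm (a 0, a 1) := by
    ext a; rfl
  rw [this]
  exact Complex.equivRealProdCLM.symm.continuous.measurable.comp (by fun_prop)

lemma measurable_slopeAngle : Measurable slopeAngle := by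
  refine Measurable.subtype_mk (Measurable.div_const ?_ _)
  exact Complex.measurable_arg.comp (measurable_slopeComplex.pow_const 2)

lemma sq_slopeSize (a : E2) : (slopeSize a : ℝ) ^ 2 = 1 + ‖a‖ ^ 2 :=
  Real.sq_sqrt (by positivity)

/-- Squaring a complex number identifies it with its opposite, so half the argument of the square is
its direction modulo `π`. The factor `q` is therefore plus or minus the norm. -/
lemma exists_eq_mul_cos_sin_slopeAngle (a : E2) : ∃ q : ℝ,
    a 0 = q * Real.cos (slopeAngle a) ∧ a 1 = q * Real.sin (slopeAngle a) := by
  set z := slopeComplex a with hz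
  have h1 : z ^ 2 = ((‖z‖ : ℂ) * Complex.exp ((slopeAngle a : ℝ) * Complex.I)) ^ 2 := by
    rw [mul_pow, ← Complex.exp_nat_mul]
    conv_lhs => rw [← Complex.norm_mul_exp_arg_mul_I (z ^ 2)]
    rw [norm_pow]
    push_cast
    congr 2
    simp only [slopeAngle, ← hz]
    push_cast
    ring
  have h2 : ∀ r : ℝ, z = (r : ℂ) * Complex.exp ((slopeAngle a : ℝ) * Complex.I) →
      a 0 = r * Real.cos (slopeAngle a) ∧ a 1 = r * Real.sin (slopeAngle a) := by
    intro r hr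
    have hre := congrArg Complex.re hr
    have him := congrArg Complex.im hr
    rw [Complex.re_ofReal_mul, Complex.exp_ofReal_mul_I_re] at hre
    rw [Complex.im_ofReal_mul, Complex.exp_ofReal_mul_I_im] at him
    exact ⟨hre, him⟩
  rcases sq_eq_sq_iff_eq_or_eq_neg.1 h1 with h | h
  · exact ⟨_, h2 _ h⟩
  · exact ⟨-‖z‖, h2 _ (h.trans (by push_cast; ring))⟩

/-- The parameters of the horizontal section of a cylinder. -/
noncomputable def horizontalSection (l : Line) : EllipseParam :=
  (l.trace, (slopeSize l.slope, slopeAngle l.slope))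

lemma measurable_horizontalSection : Measurable horizontalSection :=
  Line.measurable_trace.prodMk
    ((measurable_slopeSize.comp Line.measurable_slope).prodMk
      (measurable_slopeAngle.comp Line.measurable_slope))

/-- The set of lines that are parallel to the horizontal plane. -/
def horizontalLines : Set Line := {l | Line.cosSq (E3.basisVec 2) l = 0}

lemma Line.measurable_cosSq_right (v : E3) : Measurable (Line.cosSq v) :=
  Line.measurable_cosSq.comp (f := Prod.mk v) measurable_prodMk_left

lemma measurableSet_horizontalLines : MeasurableSet horizontalLines :=
  Line.measurable_cosSq_right _ (measurableSet_singleton 0)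

lemma cosSq_basisVec_ofPointDir (p : E3) (w : Metric.sphere (0 : E3) 1) :
    Line.cosSq (E3.basisVec 2) (Line.ofPointDir p w) = (w : E3) 2 ^ 2 := by
  rw [Line.cosSq_ofPointDir, E3.inner_eq]
  simp

lemma ofPointDir_mem_horizontalLines {p : E3} {w : Metric.sphere (0 : E3) 1} :
    Line.ofPointDir p w ∈ horizontalLines ↔ (w : E3) 2 = 0 := by
  rw [horizontalLines, Set.mem_ofPred_eq, cosSq_basisVec_ofPointDir, sq_eq_zero_iff]

lemma direction_le_of_mem_horizontalLines {l : Line} (hl : l ∈ horizontalLines) :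
    l.carrier.direction ≤ LinearMap.range horizontal.toLinearMap := by
  rw [← Line.ofPointDir_pt_dir l] at hl ⊢
  rw [Line.direction_ofPointDir, Submodule.span_singleton_le_iff_mem]
  exact mem_range_horizontal (ofPointDir_mem_horizontalLines.1 hl)

/-- For a unit vector `w`, dividing `w₀² + w₁² + w₂² = 1` by `w₂²` gives `1 + ‖a‖² = 1 / w₂²`. -/
lemma cosSq_eq_inv_sq_slopeSize {l : Line} (hl : l ∉ horizontalLines) :
    Line.cosSq (E3.basisVec 2) l = ((slopeSize l.slope : ℝ) ^ 2)⁻¹ := by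
  rw [sq_slopeSize]
  rw [← Line.ofPointDir_pt_dir l] at hl ⊢
  set w := l.dir
  have hw := E3.norm_sq_of_mem_sphere w
  have h2 : (w : E3) 2 ≠ 0 := fun h => hl (ofPointDir_mem_horizontalLines.2 h)
  rw [cosSq_basisVec_ofPointDir, Line.slope_ofPointDir, E2.norm_sq_eq]
  have h3 : 1 + ((w : E3) 0 / (w : E3) 2) ^ 2 + ((w : E3) 1 / (w : E3) 2) ^ 2
      = ((w : E3) 2 ^ 2)⁻¹ := by
    field_simp
    linarith
  simp only [Matrix.cons_val_zero, Matrix.cons_val_one]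
  rw [← add_assoc, h3, inv_inv]

/-- The displacement from the trace splits into a horizontal component orthogonal to the line, which
counts fully in the distance to the line, and one in the direction of the slope, which is shortened
by the cosine `1/R`. -/
lemma mem_cylinder_iff_mem_ellipse {l : Line} (hl : l ∉ horizontalLines) (x : E2) :
    horizontal x ∈ l.cylinder ↔ x ∈ ellipse (horizontalSection l) := by
  have hcos := cosSq_eq_inv_sq_slopeSize hl
  obtain ⟨q, hq0, hq1⟩ := exists_eq_mul_cos_sin_slopeAngle l.slope
  rw [horizontalSection]
  simp only [ellipse, Set.mem_ofPred_eq]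
  generalize slopeAngle l.slope = V at hq0 hq1 ⊢
  rw [div_pow]
  have hR := sq_slopeSize l.slope
  rw [E2.norm_sq_eq, hq0, hq1] at hR
  have hcs := Real.sin_sq_add_cos_sq V
  replace hR : (slopeSize l.slope : ℝ) ^ 2 = 1 + q ^ 2 := by
    rw [hR]; linear_combination q ^ 2 * hcs
  rw [hR] at hcos ⊢
  have hR0 : (1 + q ^ 2) ≠ 0 := by positivity
  rw [← Line.ofPointDir_pt_dir l] at hl hcos hq0 hq1 ⊢
  generalize l.dir = w at *
  generalize l.pt = p at *
  have h2 : (w : E3) 2 ≠ 0 := fun h => hl (ofPointDir_mem_horizontalLines.2 h)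
  rw [cosSq_basisVec_ofPointDir] at hcos
  rw [Line.slope_ofPointDir] at hq0 hq1
  rw [Line.mem_cylinder_ofPointDir, E3.norm_sq_eq, E3.inner_eq]
  simp only [Matrix.cons_val_zero, Matrix.cons_val_one] at hq0 hq1
  have hz0 : (Line.ofPointDir p w).trace 0 = p 0 - p 2 * (q * Real.cos V) := by
    rw [Line.trace_ofPointDir, ← hq0]; simp; field_simp
  have hz1 : (Line.ofPointDir p w).trace 1 = p 1 - p 2 * (q * Real.sin V) := by
    rw [Line.trace_ofPointDir, ← hq1]; simp; field_simp
  rw [div_eq_iff h2] at hq0 hq1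
  generalize (Line.ofPointDir p w).trace = z at *
  simp only [PiLp.sub_apply, horizontal_apply_zero, horizontal_apply_one, horizontal_apply_two]
  rw [hq0, hq1]
  obtain ⟨d0, hd0⟩ : ∃ d, x 0 - z 0 = d := ⟨_, rfl⟩
  obtain ⟨d1, hd1⟩ : ∃ d, x 1 - z 1 = d := ⟨_, rfl⟩
  have e0 : x 0 - p 0 = d0 - p 2 * (q * Real.cos V) := by rw [← hd0, hz0]; ring
  have e1 : x 1 - p 1 = d1 - p 2 * (q * Real.sin V) := by rw [← hd1, hz1]; ring
  rw [hd0, hd1, e0, e1]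
  have hw : (w : E3) 2 ^ 2 * (1 + q ^ 2) = 1 := by rw [hcos]; exact inv_mul_cancel₀ hR0
  have hdiv : (d0 * Real.cos V + d1 * Real.sin V) ^ 2 / (1 + q ^ 2)
      = (w : E3) 2 ^ 2 * (d0 * Real.cos V + d1 * Real.sin V) ^ 2 := by rw [hcos]; ring
  rw [hdiv]
  generalize (w : E3) 2 = k at *
  generalize p 2 = h at *
  generalize Real.cos V = c at *
  generalize Real.sin V = s at *
  -- The height `h` of the chosen base point drops out, as it must. Besides `c² + s² = 1`, the only
  -- relation needed is the normalization `hw` of the direction.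
  have key : (d0 - h * (q * c)) ^ 2 + (d1 - h * (q * s)) ^ 2 + (0 - h) ^ 2
      - ((d0 - h * (q * c)) * (q * c * k) + (d1 - h * (q * s)) * (q * s * k) + (0 - h) * k) ^ 2
      = k ^ 2 * (d0 * c + d1 * s) ^ 2 + (-d0 * s + d1 * c) ^ 2 := by
    have i1 : (d0 - h * (q * c)) * (q * c * k) + (d1 - h * (q * s)) * (q * s * k) + (0 - h) * k
        = k * (q * (d0 * c + d1 * s) - h * (1 + q ^ 2)) := by
      linear_combination (-h * q ^ 2 * k) * hcs
    have i2 : (d0 - h * (q * c)) ^ 2 + (d1 - h * (q * s)) ^ 2 + (0 - h) ^ 2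
        = (d0 * c + d1 * s) ^ 2 + (-d0 * s + d1 * c) ^ 2 - 2 * h * q * (d0 * c + d1 * s)
          + h ^ 2 * (1 + q ^ 2) := by
      linear_combination (h ^ 2 * q ^ 2 - d0 ^ 2 - d1 ^ 2) * hcs
    rw [i1, i2]
    linear_combination (-(d0 * c + d1 * s) ^ 2 + 2 * h * q * (d0 * c + d1 * s)
      - h ^ 2 * (1 + q ^ 2)) * hw
  rw [key]

/-! ### Invariant measures on the space of lines -/

namespace Line

lemma map_symm_map (f : E3 ≃ᵃⁱ[ℝ] E3) (l : Line) : map f.symm (map f l) = l := by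
  rw [← ofPointDir_pt_dir l]
  simp only [map_ofPointDir]
  congr 1
  · simp
  · ext1
    exact f.linearIsometryEquiv.symm_apply_apply _

lemma cosSq_map_toAffineIsometryEquiv (g : E3 ≃ₗᵢ[ℝ] E3) (v : E3) (l : Line) :
    cosSq (g v) (map g.toAffineIsometryEquiv l) = cosSq v l := by
  rw [← ofPointDir_pt_dir l, map_ofPointDir, cosSq_ofPointDir, cosSq_ofPointDir]
  change inner ℝ (g v) (g l.dir) ^ 2 = _
  rw [g.inner_map_map]

lemma cosSq_map_constVAdd (u v : E3) (l : Line) :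
    cosSq v (map (AffineIsometryEquiv.constVAdd ℝ E3 u) l) = cosSq v l := by
  rw [← ofPointDir_pt_dir l, map_ofPointDir, cosSq_ofPointDir, cosSq_ofPointDir]
  rfl

lemma pt_mem (l : Line) : l.pt ∈ l.carrier := by
  have h : l.pt ∈ (ofPointDir l.pt l.dir).carrier := mem_ofPointDir.2 ⟨0, by simp⟩
  rwa [ofPointDir_pt_dir] at h

/-- The lines at distance at most `1` from a point. -/
def near (x : E3) : Set Line := {l | x ∈ l.cylinder}

lemma measurableSet_near (x : E3) : MeasurableSet (near x) := by
  change MeasurableSet {q : E3 × Metric.sphere (0 : E3) 1 | x ∈ (ofPointDir q.1 q.2).cylinder}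
  simp_rw [mem_cylinder_ofPointDir]
  refine measurableSet_le ?_ measurable_const
  fun_prop

end Line

namespace IsInvariantLineMeasure

variable {μ : Measure Line}

lemma map_constVAdd (h : IsInvariantLineMeasure μ) (v : E3) :
    μ.map (Line.map (AffineIsometryEquiv.constVAdd ℝ E3 v)) = μ := by
  ext A hA
  rw [Measure.map_apply (Line.measurable_map _) hA, h.translation v A hA]

lemma map_rotation (h : IsInvariantLineMeasure μ) (g : E3 ≃ₗᵢ[ℝ] E3)
    (hg : LinearMap.det (g.toLinearEquiv : E3 →ₗ[ℝ] E3) = 1) :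
    μ.map (Line.map g.toAffineIsometryEquiv) = μ := by
  ext A hA
  rw [Measure.map_apply (Line.measurable_map _) hA, h.rotation g hg A hA]

lemma measure_near_zero_lt_top (h : IsInvariantLineMeasure μ) : μ (Line.near 0) < ∞ := by
  refine (measure_mono ?_).trans_lt (h.locallyFinite 1)
  rintro l ⟨y, hy, hd⟩
  exact ⟨y, hy, by rwa [dist_zero_left] at hd⟩

/-- A translation invariant set of lines is a null set as soon as almost no line of the set
comes near the origin. -/
lemma measure_eq_zero_of_near (h : IsInvariantLineMeasure μ) {A : Set Line}
    (hA : MeasurableSet A)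
    (hinv : ∀ v, Line.map (AffineIsometryEquiv.constVAdd ℝ E3 v) ⁻¹' A = A)
    (h0 : μ (A ∩ Line.near 0) = 0) : μ A = 0 := by
  have h1 : ∀ x, μ (A ∩ Line.near x) = 0 := by
    intro x
    have e : A ∩ Line.near x
        = Line.map (AffineIsometryEquiv.constVAdd ℝ E3 (-x)) ⁻¹' (A ∩ Line.near 0) := by
      rw [Set.preimage_inter, hinv]
      congr 1
      ext l
      change _ ↔ (0 : E3) ∈ (Line.map _ l).cylinder
      rw [show (0 : E3) = AffineIsometryEquiv.constVAdd ℝ E3 (-x) x by simp,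
        Line.mem_cylinder_map]
      rfl
    rw [e, h.translation _ _ (hA.inter (Line.measurableSet_near 0)), h0]
  obtain ⟨S, hS, hd⟩ := TopologicalSpace.exists_countable_dense E3
  have hcov : A ⊆ ⋃ x ∈ S, A ∩ Line.near x := by
    intro l hl
    obtain ⟨x, hx, hxd⟩ := Metric.dense_iff.1 hd l.pt 1 one_pos
    exact Set.mem_biUnion hxd ⟨hl, l.pt, l.pt_mem, (Metric.mem_ball.1 hx).le⟩
  refine measure_mono_null hcov ?_
  rw [measure_biUnion_null_iff hS]
  exact fun x _ => h1 x

end IsInvariantLineMeasure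

/-- Every plane is the image of the horizontal plane under an isometry of the 3-space that
preserves all invariant measures on the space of lines. -/
lemma exists_isometry_comp_horizontal (ι : E2 →ᵃⁱ[ℝ] E3) :
    ∃ f : E3 ≃ᵃⁱ[ℝ] E3, (∀ x, f (horizontal x) = ι x) ∧
      (∀ v, f.linearIsometryEquiv (horizontal v) = ι.linear v) ∧
      ∀ μ, IsInvariantLineMeasure μ → μ.map (Line.map f.symm) = μ := by
  obtain ⟨g, hg, hgL⟩ := exists_rotation_comp_horizontal ι.linearIsometry
  let f := g.toAffineIsometryEquiv.trans (AffineIsometryEquiv.constVAdd ℝ E3 (ι 0))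
  refine ⟨f, fun x => ?_, fun v => ?_, fun μ h => ?_⟩
  · change ι 0 + g (horizontal x) = ι x
    rw [hgL]
    have := ι.map_vadd 0 x
    rw [vadd_eq_add, add_zero, vadd_eq_add] at this
    rw [this, add_comm]
  · exact hgL v
  · have h1 : μ.map (Line.map f) = μ := by
      have : Line.map f = Line.map (AffineIsometryEquiv.constVAdd ℝ E3 (ι 0)) ∘
          Line.map g.toAffineIsometryEquiv := by
        ext1 l; exact Line.map_trans _ _ _
      rw [this, ← Measure.map_map (Line.measurable_map _) (Line.measurable_map _),
        h.map_rotation g hg, h.map_constVAdd]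
    conv_lhs => rw [← h1]
    rw [Measure.map_map (Line.measurable_map _) (Line.measurable_map _)]
    have : Line.map f.symm ∘ Line.map f = id := by
      ext1 l; exact Line.map_symm_map f l
    rw [this, Measure.map_id]

/-! ### The law of the angle of a line near the origin and the vertical axis -/

lemma lintegral_comp_vertical_norm_sq {F : ℝ → ℝ → ℝ≥0∞} (hF : Measurable (Function.uncurry F)) :
    ∫⁻ v : E3, F (v 2) (‖v‖ ^ 2) = ∫⁻ z : ℝ, ∫⁻ y : E2, F z (z ^ 2 + ‖y‖ ^ 2) := by
  have h1 := (PiLp.volume_preserving_ofLp (Fin 3))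
  have h2 := volume_preserving_piFinSuccAbove (fun _ : Fin 3 => ℝ) 2
  have h3 : MeasurePreserving (fun p : E2 => (p : Fin 2 → ℝ)) := PiLp.volume_preserving_ofLp (Fin 2)
  have hm : Measurable fun p : ℝ × (Fin 2 → ℝ) => F p.1 (p.1 ^ 2 + (p.2 0 ^ 2 + p.2 1 ^ 2)) :=
    hF.comp (f := fun p : ℝ × (Fin 2 → ℝ) => (p.1, p.1 ^ 2 + (p.2 0 ^ 2 + p.2 1 ^ 2)))
      (by fun_prop)
  have h4 := (h2.comp h1).lintegral_comp hm
  have h5 : ∀ v : E3, F (v 2) (‖v‖ ^ 2) = F (v 2) (v 2 ^ 2 + (v 0 ^ 2 + v 1 ^ 2)) := by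
    intro v; rw [E3.norm_sq_eq]; congr 1; ring
  simp_rw [h5]
  refine Eq.trans ?_ (h4.trans ?_)
  · rfl
  · rw [Measure.volume_eq_prod, lintegral_prod _ hm.aemeasurable]
    refine lintegral_congr fun z => ?_
    have h6 := h3.lintegral_comp (f := fun y => F z (z ^ 2 + (y 0 ^ 2 + y 1 ^ 2)))
      (hm.comp measurable_prodMk_left)
    rw [← h6]
    simp_rw [E2.norm_sq_eq]

lemma volume_norm_sq_lt (β : ℝ) :
    volume {y : E2 | ‖y‖ ^ 2 < β} = ENNReal.ofReal (Real.pi * β) := by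
  rcases le_or_gt β 0 with hβ | hβ
  · have : {y : E2 | ‖y‖ ^ 2 < β} = ∅ :=
      Set.eq_empty_of_forall_notMem fun y hy => absurd (lt_of_lt_of_le hy hβ) (sq_nonneg ‖y‖).not_gt
    rw [this, measure_empty, ENNReal.ofReal_of_nonpos]
    exact mul_nonpos_of_nonneg_of_nonpos Real.pi_pos.le hβ
  · have : {y : E2 | ‖y‖ ^ 2 < β} = Metric.ball 0 (√β) := by
      ext y
      rw [mem_ball_zero_iff, Real.lt_sqrt (norm_nonneg _)]
      rfl
    rw [this, EuclideanSpace.volume_ball_fin_two, ← ENNReal.ofReal_pow (Real.sqrt_nonneg _),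
      Real.sq_sqrt hβ.le, ← ENNReal.ofReal_mul hβ.le, mul_comm]

/-- When `β ≤ α` both sides vanish, since `ENNReal.ofReal` truncates at `0`. Thus the slices below
need no bound on the height. -/
lemma volume_norm_sq_mem_Ico {α β : ℝ} (hα : 0 ≤ α) :
    volume {y : E2 | α ≤ ‖y‖ ^ 2 ∧ ‖y‖ ^ 2 < β} = ENNReal.ofReal (Real.pi * (β - α)) := by
  rcases le_or_gt β α with h | h
  · have : {y : E2 | α ≤ ‖y‖ ^ 2 ∧ ‖y‖ ^ 2 < β} = ∅ :=
      Set.eq_empty_of_forall_notMem fun y hy => absurd (hy.1.trans_lt hy.2) h.not_gt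
    rw [this, measure_empty, ENNReal.ofReal_of_nonpos]
    exact mul_nonpos_of_nonneg_of_nonpos Real.pi_pos.le (sub_nonpos.2 h)
  · have e : {y : E2 | α ≤ ‖y‖ ^ 2 ∧ ‖y‖ ^ 2 < β}
        = {y : E2 | ‖y‖ ^ 2 < β} \ {y : E2 | ‖y‖ ^ 2 < α} := by
      ext y
      simp [and_comm]
    rw [e, measure_sdiff, volume_norm_sq_lt, volume_norm_sq_lt, mul_sub, ENNReal.ofReal_sub]
    · exact mul_nonneg Real.pi_pos.le hα
    · exact fun y hy => lt_trans hy h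
    · exact (measurableSet_lt (by fun_prop) measurable_const).nullMeasurableSet
    · rw [volume_norm_sq_lt]; exact ENNReal.ofReal_ne_top

lemma lintegral_comp_inv_mul {H : ℝ → ℝ≥0∞} (hH : Measurable H) {t : ℝ} (ht : 0 < t) :
    ∫⁻ z, H (t⁻¹ * z) = ENNReal.ofReal t * ∫⁻ z, H z := by
  have h := Real.map_volume_mul_left (inv_ne_zero ht.ne')
  rw [← lintegral_map (f := H) (g := fun z => t⁻¹ * z) hH (by fun_prop), h,
    lintegral_smul_measure, inv_inv, abs_of_pos ht, smul_eq_mul]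

/-- The weight `|⟨v, w⟩|` on the set of all `v` in the unit ball whose angle to `w` has a cosine of
absolute value at most `t`, as a function of `‖v‖` and `⟨v, w⟩ ^ 2`. -/
noncomputable def zoneWeight (t r q : ℝ) : ℝ≥0∞ :=
  if r < 1 ∧ q ≤ t ^ 2 * r ^ 2 then ENNReal.ofReal √q else 0

lemma measurable_zoneWeight (t : ℝ) : Measurable (Function.uncurry (zoneWeight t)) := by
  refine Measurable.ite ?_ (by fun_prop) measurable_const
  exact (measurableSet_lt measurable_fst measurable_const).inter
    (measurableSet_le measurable_snd (by fun_prop))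

/-- The slice at height `z` is an annulus of area `π (1 - (z/t)²)`. Substituting `z = t z'` yields
one factor `t` from `dz` and one from the weight `|z|`. The assumption `t ≤ 1` keeps the squared
inner radius nonnegative. -/
lemma lintegral_zoneWeight {t : ℝ} (ht : 0 < t) (ht1 : t ≤ 1) :
    ∫⁻ v : E3, zoneWeight t ‖v‖ (v 2 ^ 2)
      = ENNReal.ofReal (t ^ 2) *
        ∫⁻ z : ℝ, ENNReal.ofReal |z| * ENNReal.ofReal (Real.pi * (1 - z ^ 2)) := by
  let F : ℝ → ℝ → ℝ≥0∞ := fun z s => if s < 1 ∧ z ^ 2 ≤ t ^ 2 * s then ENNReal.ofReal |z| else 0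
  have hF : Measurable (Function.uncurry F) := by
    refine Measurable.ite ?_ (by fun_prop) measurable_const
    exact (measurableSet_lt measurable_snd measurable_const).inter
      (measurableSet_le (measurable_fst.pow_const 2) (measurable_snd.const_mul _))
  have h1 : ∀ v : E3, zoneWeight t ‖v‖ (v 2 ^ 2) = F (v 2) (‖v‖ ^ 2) := by
    intro v
    simp only [zoneWeight, F, Real.sqrt_sq_eq_abs, sq_lt_one_iff₀ (norm_nonneg v)]
  simp_rw [h1]
  rw [lintegral_comp_vertical_norm_sq hF]
  let H : ℝ → ℝ≥0∞ := fun z => ENNReal.ofReal |z| * ENNReal.ofReal (Real.pi * (1 - z ^ 2))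
  have hH : Measurable H := by fun_prop
  have h2 : ∀ z : ℝ, ∫⁻ y : E2, F z (z ^ 2 + ‖y‖ ^ 2) = ENNReal.ofReal t * H (t⁻¹ * z) := by
    intro z
    have hα : 0 ≤ (t⁻¹ * z) ^ 2 - z ^ 2 := by
      have : z ^ 2 ≤ (t⁻¹ * z) ^ 2 := by
        rw [mul_pow]
        exact le_mul_of_one_le_left (sq_nonneg _)
          (one_le_pow₀ ((one_le_inv₀ ht).2 ht1))
      linarith
    have e : ∀ y : E2, F z (z ^ 2 + ‖y‖ ^ 2) = Set.indicator
        {y : E2 | (t⁻¹ * z) ^ 2 - z ^ 2 ≤ ‖y‖ ^ 2 ∧ ‖y‖ ^ 2 < 1 - z ^ 2}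
        (fun _ => ENNReal.ofReal |z|) y := by
      intro y
      simp only [F, Set.indicator, Set.mem_ofPred_eq]
      have i1 : z ^ 2 + ‖y‖ ^ 2 < 1 ↔ ‖y‖ ^ 2 < 1 - z ^ 2 := by
        constructor <;> intro <;> linarith
      have i2 : z ^ 2 ≤ t ^ 2 * (z ^ 2 + ‖y‖ ^ 2) ↔ (t⁻¹ * z) ^ 2 - z ^ 2 ≤ ‖y‖ ^ 2 := by
        rw [mul_pow, inv_pow, sub_le_iff_le_add, inv_mul_le_iff₀ (by positivity),
          add_comm (‖y‖ ^ 2)]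
      simp only [i1, i2, and_comm]
    simp_rw [e]
    rw [lintegral_indicator_const, volume_norm_sq_mem_Ico hα]
    · simp only [H]
      rw [← mul_assoc, ← ENNReal.ofReal_mul ht.le, abs_mul, abs_inv, abs_of_pos ht,
        mul_inv_cancel_left₀ ht.ne']
      congr 3
      ring
    · exact (measurableSet_le measurable_const (measurable_norm.pow_const 2)).inter
        (measurableSet_lt (measurable_norm.pow_const 2) measurable_const)
  simp_rw [h2]
  rw [lintegral_const_mul _ (by fun_prop), lintegral_comp_inv_mul hH ht, ← mul_assoc,
    ← ENNReal.ofReal_mul ht.le, sq]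

/-! ### Double integration over vectors and lines near the origin -/

namespace IsInvariantLineMeasure

variable {μ : Measure Line}

/-- A rotation about the origin preserves the distance of a line to the origin, so `μ` restricted to
`Line.near 0` is again rotation invariant. -/
lemma lintegral_near_comp_rotation (h : IsInvariantLineMeasure μ) (g : E3 ≃ₗᵢ[ℝ] E3)
    (hg : LinearMap.det (g.toLinearEquiv : E3 →ₗ[ℝ] E3) = 1) {F : Line → ℝ≥0∞}
    (hF : Measurable F) :
    ∫⁻ l in Line.near 0, F (Line.map g.toAffineIsometryEquiv l) ∂μ
      = ∫⁻ l in Line.near 0, F l ∂μ := by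
  conv_rhs => rw [← h.map_rotation g hg]
  rw [setLIntegral_map (Line.measurableSet_near 0) hF (Line.measurable_map _)]
  congr 2
  ext l
  change _ ↔ (0 : E3) ∈ (Line.map _ l).cylinder
  rw [show (0 : E3) = g.toAffineIsometryEquiv 0 by simp, Line.mem_cylinder_map]
  simp [Line.near]

/-- The Fubini argument that determines the law of the angle of a line to the vertical axis. -/
lemma near_mul_lintegral (h : IsInvariantLineMeasure μ) {f : ℝ → ℝ → ℝ≥0∞}
    (hf : Measurable (Function.uncurry f)) :
    μ (Line.near 0) * ∫⁻ v : E3, f ‖v‖ (v 2 ^ 2)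
      = ∫⁻ v : E3, ∫⁻ l in Line.near 0, f ‖v‖ (‖v‖ ^ 2 * Line.cosSq (E3.basisVec 2) l) ∂μ := by
  have : IsFiniteMeasure (μ.restrict (Line.near 0)) :=
    ⟨by rw [Measure.restrict_apply_univ]; exact h.measure_near_zero_lt_top⟩
  have hm : Measurable (fun q : E3 × Line => f ‖q.1‖ (Line.cosSq q.1 q.2)) :=
    hf.comp (f := fun q : E3 × Line => (‖q.1‖, Line.cosSq q.1 q.2))
      ((by fun_prop : Measurable fun q : E3 × Line => ‖q.1‖).prodMk Line.measurable_cosSq)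
  -- For a fixed line, rotating the variable `v` makes the line vertical, by invariance of Lebesgue
  -- measure.
  have h1 : ∀ l : Line, ∫⁻ v : E3, f ‖v‖ (Line.cosSq v l) = ∫⁻ v : E3, f ‖v‖ (v 2 ^ 2) := by
    intro l
    obtain ⟨g, -, hg⟩ := exists_rotation_apply_eq (l.dir : E3) (norm_eq_of_mem_sphere _)
    rw [← g.measurePreserving.lintegral_comp (f := fun v => f ‖v‖ (Line.cosSq v l))
      (hm.comp (f := fun v => (v, l)) measurable_prodMk_right)]
    refine lintegral_congr fun v => ?_
    simp only [g.norm_map, Line.cosSq, ← hg, g.inner_map_map]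
    rw [E3.inner_eq]
    simp
  -- For a fixed vector, rotating the lines makes the vector vertical, by invariance of `μ`.
  have h2 : ∀ v : E3, ∫⁻ l in Line.near 0, f ‖v‖ (Line.cosSq v l) ∂μ
      = ∫⁻ l in Line.near 0, f ‖v‖ (‖v‖ ^ 2 * Line.cosSq (E3.basisVec 2) l) ∂μ := by
    intro v
    rcases eq_or_ne v 0 with rfl | hv
    · simp [Line.cosSq]
    obtain ⟨g, hdet, hg⟩ := exists_rotation_apply_eq (‖v‖⁻¹ • v) (norm_smul_inv_norm hv)
    have hg' : g (‖v‖ • E3.basisVec 2) = v := by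
      rw [map_smul, hg, smul_inv_smul₀ (norm_ne_zero_iff.2 hv)]
    rw [← h.lintegral_near_comp_rotation g hdet (F := fun l => f ‖v‖ (Line.cosSq v l))
      (hm.comp (f := Prod.mk v) measurable_prodMk_left)]
    refine lintegral_congr fun l => ?_
    congr 1
    conv_lhs => rw [← hg']
    rw [Line.cosSq_map_toAffineIsometryEquiv, Line.cosSq_smul]
  calc μ (Line.near 0) * ∫⁻ v : E3, f ‖v‖ (v 2 ^ 2)
      = ∫⁻ l in Line.near 0, (∫⁻ v : E3, f ‖v‖ (Line.cosSq v l)) ∂μ := by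
        simp_rw [h1]
        rw [lintegral_const, Measure.restrict_apply_univ, mul_comm]
    _ = ∫⁻ v : E3, ∫⁻ l in Line.near 0, f ‖v‖ (Line.cosSq v l) ∂μ :=
        (lintegral_lintegral_swap hm.aemeasurable).symm
    _ = _ := lintegral_congr h2

/-- Double integration of the indicator of `v ⟂ l`, `‖v‖ < 1`: for each line the orthogonal vectors
lie in a plane of volume `0`, so horizontal lines near the origin are negligible. Translations then
handle all the others. -/
lemma measure_horizontalLines (h : IsInvariantLineMeasure μ) : μ horizontalLines = 0 := by
  refine h.measure_eq_zero_of_near measurableSet_horizontalLines (fun v => ?_) ?_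
  · ext l
    simp [horizontalLines, Line.cosSq_map_constVAdd]
  let f : ℝ → ℝ → ℝ≥0∞ := fun r q => if r < 1 ∧ q = 0 then 1 else 0
  have hf : Measurable (Function.uncurry f) := by
    refine Measurable.ite ?_ measurable_const measurable_const
    exact (measurableSet_lt measurable_fst measurable_const).inter
      (measurable_snd (measurableSet_singleton 0))
  have h1 := h.near_mul_lintegral hf
  have h2 : ∫⁻ v : E3, f ‖v‖ (v 2 ^ 2) = 0 := by
    have h3 := lintegral_comp_vertical_norm_sq
      (F := fun z _ => if z = 0 then 1 else 0)
      (Measurable.ite (measurable_fst (measurableSet_singleton 0)) measurable_const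
        measurable_const)
    have h4 : ∫⁻ z : ℝ, ∫⁻ _ : E2, (if z = 0 then (1 : ℝ≥0∞) else 0) = 0 := by
      rw [lintegral_eq_zero_iff']
      · filter_upwards [Measure.ae_ne volume (0 : ℝ)] with z hz
        simp [hz]
      · exact (Measurable.lintegral_prod_right' (f := fun p : ℝ × E2 => if p.1 = 0 then 1 else 0)
          (Measurable.ite (measurable_fst (measurableSet_singleton 0)) measurable_const
          measurable_const)).aemeasurable
    rw [h4] at h3
    refine le_antisymm (le_trans (lintegral_mono fun v => ?_) h3.le) (zero_le)
    simp only [f]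
    split_ifs with i j
    · exact le_rfl
    · exact absurd (pow_eq_zero_iff two_ne_zero |>.1 i.2) j
    · exact zero_le
    · exact le_rfl
  rw [h2, mul_zero] at h1
  have h5 : ∫⁻ _ in Metric.ball (0 : E3) 1, μ (horizontalLines ∩ Line.near 0) ≤ 0 := by
    rw [h1, ← lintegral_indicator measurableSet_ball]
    refine lintegral_mono fun v => ?_
    by_cases hv : v ∈ Metric.ball (0 : E3) 1
    · rw [Set.indicator_of_mem hv]
      rw [← Measure.restrict_apply measurableSet_horizontalLines,
        ← lintegral_indicator_one measurableSet_horizontalLines]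
      refine lintegral_mono fun l => ?_
      by_cases hl : l ∈ horizontalLines
      · have hl' : Line.cosSq (E3.basisVec 2) l = 0 := hl
        rw [Set.indicator_of_mem hl]
        simp [f, hl', mem_ball_zero_iff.1 hv]
      · rw [Set.indicator_of_notMem hl]; exact zero_le
    · rw [Set.indicator_of_notMem hv]; exact zero_le
  rw [setLIntegral_const] at h5
  refine (mul_eq_zero.1 (le_antisymm h5 (zero_le))).resolve_right ?_
  exact (Metric.measure_ball_pos _ _ one_pos).ne'

/-- The distribution function of the angle of a line near the origin and the vertical axis,
weighted with the cosine. -/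
lemma lintegral_near_zone (h : IsInvariantLineMeasure μ) {t : ℝ} (ht : 0 < t) (ht1 : t ≤ 1) :
    ∫⁻ l in Line.near 0, (if Line.cosSq (E3.basisVec 2) l ≤ t ^ 2 then
        ENNReal.ofReal √(Line.cosSq (E3.basisVec 2) l) else 0) ∂μ
      = ENNReal.ofReal (t ^ 2) *
        ∫⁻ l in Line.near 0, (if Line.cosSq (E3.basisVec 2) l ≤ 1 ^ 2 then
          ENNReal.ofReal √(Line.cosSq (E3.basisVec 2) l) else 0) ∂μ := by
  let k : E3 → ℝ≥0∞ := fun v => if ‖v‖ < 1 then ENNReal.ofReal ‖v‖ else 0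
  let G : ℝ → Line → ℝ≥0∞ := fun t l => if Line.cosSq (E3.basisVec 2) l ≤ t ^ 2 then
    ENNReal.ofReal √(Line.cosSq (E3.basisVec 2) l) else 0
  have hc := Line.measurable_cosSq_right (E3.basisVec 2)
  have hG : ∀ t, Measurable (G t) := fun t =>
    Measurable.ite (measurableSet_le hc measurable_const)
      (Real.continuous_sqrt.measurable.comp hc).ennreal_ofReal measurable_const
  have hk : Measurable k := Measurable.ite (measurableSet_lt measurable_norm measurable_const)
    measurable_norm.ennreal_ofReal measurable_const
  have hzone : ∀ (t : ℝ) (v : E3) (l : Line),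
      zoneWeight t ‖v‖ (‖v‖ ^ 2 * Line.cosSq (E3.basisVec 2) l) = k v * G t l := by
    intro t v l
    rcases eq_or_ne v 0 with rfl | hv
    · simp [zoneWeight, k]
    have hv' : 0 < ‖v‖ ^ 2 := by positivity
    have i : ‖v‖ ^ 2 * Line.cosSq (E3.basisVec 2) l ≤ t ^ 2 * ‖v‖ ^ 2
        ↔ Line.cosSq (E3.basisVec 2) l ≤ t ^ 2 := by
      rw [mul_comm, mul_le_mul_iff_left₀ hv']
    simp only [zoneWeight, k, G, i, Real.sqrt_mul hv'.le, Real.sqrt_sq (norm_nonneg v),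
      ENNReal.ofReal_mul (norm_nonneg v)]
    split_ifs <;> simp_all
  -- The constants on both sides do not depend on `t`, so comparison with `t = 1` eliminates them
  -- without evaluating any; it suffices that `∫ k` is neither `0` nor `∞`.
  have key : ∀ t : ℝ, 0 < t → t ≤ 1 → ENNReal.ofReal (t ^ 2) * (μ (Line.near 0) *
      ∫⁻ z : ℝ, ENNReal.ofReal |z| * ENNReal.ofReal (Real.pi * (1 - z ^ 2)))
      = (∫⁻ v, k v) * ∫⁻ l in Line.near 0, G t l ∂μ := by
    intro t ht ht1
    have h1 := h.near_mul_lintegral (measurable_zoneWeight t)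
    simp_rw [hzone] at h1
    simp_rw [lintegral_const_mul _ (hG t)] at h1
    rw [lintegral_mul_const _ hk, lintegral_zoneWeight ht ht1] at h1
    rw [← h1]
    ring
  have hk0 : ∫⁻ v, k v ≠ 0 := by
    refine ((lintegral_pos_iff_support hk).2 ?_).ne'
    have : Metric.ball (0 : E3) 1 \ {0} ⊆ Function.support k := by
      rintro v ⟨hv, hv0⟩
      have hv0' : v ≠ 0 := hv0
      simpa [k, mem_ball_zero_iff.1 hv] using hv0'
    refine lt_of_lt_of_le ?_ (measure_mono this)
    rw [measure_sdiff_null (measure_singleton _)]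
    exact Metric.measure_ball_pos _ _ one_pos
  have hk1 : ∫⁻ v, k v ≠ ∞ := by
    have : ∫⁻ v, k v ≤ ∫⁻ _ in Metric.ball (0 : E3) 1, 1 := by
      rw [← lintegral_indicator measurableSet_ball]
      refine lintegral_mono fun v => ?_
      by_cases hv : ‖v‖ < 1
      · rw [Set.indicator_of_mem (mem_ball_zero_iff.2 hv)]
        simp only [k, if_pos hv]
        exact ENNReal.ofReal_le_one.2 hv.le
      · simp [k, hv]
    refine ne_top_of_le_ne_top ?_ this
    rw [setLIntegral_const, one_mul]
    exact measure_ball_lt_top.ne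
  have h1 := key 1 one_pos le_rfl
  rw [one_pow, ENNReal.ofReal_one, one_mul] at h1
  have h2 := key t ht ht1
  rw [h1, mul_left_comm] at h2
  exact ((ENNReal.mul_right_inj hk0 hk1).1 h2).symm

end IsInvariantLineMeasure

/-! ### Translation invariant measures on a product -/

/-- A measure on `G × Y` that is invariant under the translations of `G` is a product measure. -/
lemma eq_prod_of_map_add_left {G Y : Type*} [AddGroup G] [TopologicalSpace G]
    [IsTopologicalAddGroup G] [LocallyCompactSpace G] [SecondCountableTopology G] [T2Space G]
    [MeasurableSpace G] [BorelSpace G] [MeasurableSpace Y] (lam : Measure G) [lam.IsAddHaarMeasure]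
    {K : Set G} (hK : IsCompact K) (hK0 : lam K ≠ 0) {m : Measure (G × Y)}
    (hinv : ∀ g : G, m.map (fun p => (g + p.1, p.2)) = m)
    (hfin : ∀ C : Set G, IsCompact C → m (C ×ˢ Set.univ) < ∞) :
    m = lam.prod ((lam K)⁻¹ • (m.restrict (K ×ˢ Set.univ)).map Prod.snd) := by
  have hKm := hK.measurableSet
  have hKt : lam K ≠ ∞ := hK.measure_lt_top.ne
  have h1 : IsFiniteMeasure (m.restrict (K ×ˢ Set.univ)) :=
    ⟨by rw [Measure.restrict_apply_univ]; exact hfin K hK⟩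
  have h2 : IsFiniteMeasure ((lam K)⁻¹ • (m.restrict (K ×ˢ Set.univ)).map Prod.snd) :=
    Measure.smul_finite _ (ENNReal.inv_ne_top.2 hK0)
  symm
  refine Measure.prod_eq fun s t hs ht => ?_
  -- For fixed `t`, the measure `s ↦ m (s ×ˢ t)` is invariant, hence a multiple of `lam`; the set
  -- `K` reads off the multiple.
  let η : Measure G := (m.restrict (Set.univ ×ˢ t)).map Prod.fst
  have hη : ∀ s, MeasurableSet s → η s = m (s ×ˢ t) := by
    intro s hs
    rw [Measure.map_apply measurable_fst hs, Measure.restrict_apply (measurable_fst hs)]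
    congr 1
    ext p
    simp
  have hη1 : η.IsAddLeftInvariant := by
    refine ⟨fun g => ?_⟩
    ext s hs
    have hg : Measurable fun x : G => g + x := (continuous_const_add g).measurable
    rw [Measure.map_apply hg hs, hη _ (hg hs), hη _ hs]
    conv_rhs => rw [← hinv g]
    rw [Measure.map_apply (f := fun p : G × Y => (g + p.1, p.2))
      ((hg.comp measurable_fst).prodMk measurable_snd) (hs.prod ht)]
    rfl
  have hη2 : IsFiniteMeasureOnCompacts η := by
    refine ⟨fun C hC => ?_⟩
    rw [hη C hC.measurableSet]
    exact (measure_mono (Set.prod_mono_right (Set.subset_univ t))).trans_lt (hfin C hC)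
  have hc := Measure.isAddLeftInvariant_eq_smul η lam
  have h3 := hη s hs
  have h4 := hη K hKm
  rw [hc] at h3 h4
  rw [← h3, Measure.smul_apply, Measure.smul_apply, Measure.map_apply measurable_snd ht,
    Measure.restrict_apply (measurable_snd ht)]
  have h5 : Prod.snd ⁻¹' t ∩ K ×ˢ Set.univ = K ×ˢ t := by
    ext p
    simp [and_comm]
  rw [h5, ← h4, Measure.smul_apply, smul_eq_mul, ENNReal.smul_def, ENNReal.smul_def, smul_eq_mul,
    smul_eq_mul, mul_left_comm (lam K)⁻¹, ENNReal.inv_mul_cancel hK0 hKt, mul_one, mul_comm]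

/-! ### The decomposition of an invariant measure by slopes -/

lemma Line.horizontal_trace_mem {l : Line} (hl : l ∉ horizontalLines) :
    horizontal l.trace ∈ l.carrier := by
  rw [← Line.ofPointDir_pt_dir l] at hl ⊢
  have h2 : (l.dir : E3) 2 ≠ 0 := fun h => hl (ofPointDir_mem_horizontalLines.2 h)
  rw [Line.mem_ofPointDir, Line.trace_ofPointDir]
  refine ⟨-l.pt 2 / (l.dir : E3) 2, ?_⟩
  ext i
  fin_cases i <;> simp [horizontal_apply] <;> field_simp <;> ring

lemma Line.slope_map_constVAdd (v : E3) (l : Line) :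
    (Line.map (AffineIsometryEquiv.constVAdd ℝ E3 v) l).slope = l.slope := by
  rw [← Line.ofPointDir_pt_dir l, Line.map_ofPointDir, Line.slope_ofPointDir,
    Line.slope_ofPointDir]
  rfl

lemma Line.trace_map_constVAdd {l : Line} (hl : l ∉ horizontalLines) (v : E2) :
    (Line.map (AffineIsometryEquiv.constVAdd ℝ E3 (horizontal v)) l).trace = v + l.trace := by
  rw [← Line.ofPointDir_pt_dir l] at hl ⊢
  have h2 : (l.dir : E3) 2 ≠ 0 := fun h => hl (ofPointDir_mem_horizontalLines.2 h)
  have e : Line.mapDir (AffineIsometryEquiv.constVAdd ℝ E3 (horizontal v)).linearIsometryEquiv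
      l.dir = l.dir := rfl
  rw [Line.map_ofPointDir, Line.trace_ofPointDir, Line.trace_ofPointDir, e]
  ext i
  fin_cases i <;> simp <;> field_simp <;> ring

lemma measurable_planeRotation (θ : ℝ) : Measurable (planeRotation θ) := by
  refine (MeasurableEquiv.toLp 2 _).measurable.comp (measurable_pi_iff.2 fun i => ?_)
  fin_cases i <;> simp <;> fun_prop

lemma norm_planeRotation (θ : ℝ) (x : E2) : ‖planeRotation θ x‖ = ‖x‖ := by
  rw [← sq_eq_sq₀ (norm_nonneg _) (norm_nonneg _), E2.norm_sq_eq, E2.norm_sq_eq]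
  simp [planeRotation]
  linear_combination (x 0 ^ 2 + x 1 ^ 2) * Real.sin_sq_add_cos_sq θ

lemma Line.slope_trace_map_rotation {g : E3 ≃ₗᵢ[ℝ] E3} {θ : ℝ}
    (hg : ∀ x, g x = !₂[Real.cos θ * x 0 - Real.sin θ * x 1,
        Real.sin θ * x 0 + Real.cos θ * x 1, x 2]) (l : Line) :
    (Line.map g.toAffineIsometryEquiv l).slope = planeRotation θ l.slope ∧
      (Line.map g.toAffineIsometryEquiv l).trace = planeRotation θ l.trace := by
  rw [← Line.ofPointDir_pt_dir l, Line.map_ofPointDir, Line.slope_ofPointDir,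
    Line.slope_ofPointDir, Line.trace_ofPointDir, Line.trace_ofPointDir]
  have e : (Line.mapDir g.toAffineIsometryEquiv.linearIsometryEquiv l.dir : E3)
    = g l.dir := rfl
  have e' : g.toAffineIsometryEquiv l.pt = g l.pt := rfl
  rw [e, e', hg, hg]
  constructor
  · ext i
    fin_cases i <;> simp [planeRotation] <;> ring
  · ext i
    fin_cases i <;> simp [planeRotation] <;> ring

/-- The slopes of the lines are distributed independently of their traces, with a finite and
rotation invariant law. -/
lemma IsInvariantLineMeasure.exists_slope_law {μ : Measure Line} (h : IsInvariantLineMeasure μ) :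
    ∃ σ : Measure E2, IsFiniteMeasure σ ∧
      μ.map (fun l => (l.trace, l.slope)) = (volume : Measure E2).prod σ ∧
      ∀ θ, σ.map (planeRotation θ) = σ := by
  have hΨ : Measurable fun l : Line => (l.trace, l.slope) :=
    Line.measurable_trace.prodMk Line.measurable_slope
  have hae : ∀ᵐ l ∂μ, l ∉ horizontalLines := measure_eq_zero_iff_ae_notMem.1 h.measure_horizontalLines
  set m := μ.map (fun l : Line => (l.trace, l.slope)) with hm
  have hinv : ∀ v : E2, m.map (fun p => (v + p.1, p.2)) = m := by
    intro v
    have hs : Measurable fun p : E2 × E2 => (v + p.1, p.2) := by fun_prop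
    rw [hm, Measure.map_map hs hΨ]
    conv_rhs => rw [← h.map_constVAdd (horizontal v), Measure.map_map hΨ (Line.measurable_map _)]
    refine Measure.map_congr ?_
    filter_upwards [hae] with l hl
    simp only [Function.comp]
    rw [Line.slope_map_constVAdd, Line.trace_map_constVAdd hl]
  -- A line with trace in `C` meets every ball about the origin that contains `C`, so local
  -- finiteness of `μ` applies.
  have hfin : ∀ C : Set E2, IsCompact C → m (C ×ˢ Set.univ) < ∞ := by
    intro C hC
    obtain ⟨r, hr⟩ := hC.isBounded.subset_closedBall 0
    refine lt_of_le_of_lt ?_ (h.locallyFinite r)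
    rw [hm, Measure.map_apply hΨ (hC.measurableSet.prod .univ)]
    refine measure_mono_ae ?_
    filter_upwards [hae] with l hl hlC
    exact ⟨_, Line.horizontal_trace_mem hl, by
      rw [horizontal.norm_map]
      exact mem_closedBall_zero_iff.1 (hr hlC.1)⟩
  have hK0 : (volume : Measure E2) (Metric.closedBall 0 1) ≠ 0 :=
    (Metric.measure_closedBall_pos _ _ one_pos).ne'
  have hKt : (volume : Measure E2) (Metric.closedBall 0 1) ≠ ∞ := measure_closedBall_lt_top.ne
  have hK : IsCompact (Metric.closedBall (0 : E2) 1) := isCompact_closedBall _ _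
  have hprod := eq_prod_of_map_add_left volume hK hK0 hinv hfin
  set σ := ((volume : Measure E2) (Metric.closedBall 0 1))⁻¹ •
    (m.restrict (Metric.closedBall 0 1 ×ˢ Set.univ)).map Prod.snd with hσ
  have h1 : IsFiniteMeasure (m.restrict (Metric.closedBall 0 1 ×ˢ Set.univ)) :=
    ⟨by rw [Measure.restrict_apply_univ]; exact hfin _ hK⟩
  have h2 : IsFiniteMeasure σ := Measure.smul_finite _ (ENNReal.inv_ne_top.2 hK0)
  refine ⟨σ, h2, hprod, fun θ => ?_⟩
  obtain ⟨g, hdet, hg⟩ := exists_rotation_vertical θ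
  have hrot := measurable_planeRotation θ
  have hs : Measurable fun p : E2 × E2 => (planeRotation θ p.1, planeRotation θ p.2) :=
    (hrot.comp measurable_fst).prodMk (hrot.comp measurable_snd)
  have hmrot : m.map (fun p => (planeRotation θ p.1, planeRotation θ p.2)) = m := by
    rw [hm, Measure.map_map hs hΨ]
    conv_rhs => rw [← h.map_rotation g hdet, Measure.map_map hΨ (Line.measurable_map _)]
    congr 1
    ext1 l
    simp only [Function.comp]
    rw [(Line.slope_trace_map_rotation hg l).1, (Line.slope_trace_map_rotation hg l).2]
  ext B hB
  -- The disc is itself rotation invariant, so testing on disc `×` `B` transfers the invariance of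
  -- the product to `σ`.
  rw [Measure.map_apply hrot hB, ← ENNReal.mul_right_inj hK0 hKt, ← Measure.prod_prod,
    ← Measure.prod_prod, ← hprod]
  conv_rhs => rw [← hmrot]
  rw [Measure.map_apply hs (hK.measurableSet.prod hB)]
  congr 1
  ext p
  simp [norm_planeRotation]

/-! ### The law of the major semi-axis -/

/-- The map `t ↦ 1 / √t` from `(0, 1]` to `[1, ∞)`. -/
noncomputable def invSqrtSize (t : ℝ) : Set.Ici (1 : ℝ) :=
  ⟨max 1 (√t)⁻¹, Set.mem_Ici.2 (le_max_left _ _)⟩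

/-- The law on `[1, ∞)` of the major semi-axis, with tail `ρ(r, ∞) = r⁻²`: the law of `1 / √t` for
`t` uniform on `(0, 1]`. -/
noncomputable def sizeLaw : Measure (Set.Ici (1 : ℝ)) :=
  (volume.restrict (Set.Ioc (0 : ℝ) 1)).map invSqrtSize

lemma measurable_invSqrtSize : Measurable invSqrtSize := by
  refine Measurable.subtype_mk ?_
  fun_prop

lemma coe_invSqrtSize {t : ℝ} (ht : 0 < t) (ht1 : t ≤ 1) : (invSqrtSize t : ℝ) = (√t)⁻¹ :=
  max_eq_right (one_le_inv₀ (Real.sqrt_pos.2 ht) |>.2 (Real.sqrt_le_one.2 ht1))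

lemma le_invSqrtSize_iff {t r : ℝ} (ht : 0 < t) (ht1 : t ≤ 1) (hr : 1 ≤ r) :
    r ≤ invSqrtSize t ↔ t ≤ (r ^ 2)⁻¹ := by
  have hr0 : 0 < r := by linarith
  rw [coe_invSqrtSize ht ht1,
    le_inv_comm₀ hr0 (Real.sqrt_pos.2 ht), Real.sqrt_le_left (by positivity), inv_pow]

lemma lt_invSqrtSize_iff {t r : ℝ} (ht : 0 < t) (ht1 : t ≤ 1) (hr : 1 ≤ r) :
    r < invSqrtSize t ↔ t < (r ^ 2)⁻¹ := by
  have hr0 : 0 < r := by linarith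
  rw [coe_invSqrtSize ht ht1,
    lt_inv_comm₀ hr0 (Real.sqrt_pos.2 ht), Real.sqrt_lt' (by positivity), inv_pow]

lemma sizeLaw_le {r : ℝ} (hr : 1 ≤ r) :
    sizeLaw {R | r ≤ (R : ℝ)} = ENNReal.ofReal ((r ^ 2)⁻¹) := by
  have hm : MeasurableSet {R : Set.Ici (1 : ℝ) | r ≤ (R : ℝ)} :=
    measurableSet_le measurable_const measurable_subtype_coe
  have h1 : (r ^ 2)⁻¹ ≤ 1 := inv_le_one_of_one_le₀ (one_le_pow₀ hr)
  rw [sizeLaw, Measure.map_apply measurable_invSqrtSize hm,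
    Measure.restrict_apply (measurable_invSqrtSize hm)]
  have e : invSqrtSize ⁻¹' {R | r ≤ (R : ℝ)} ∩ Set.Ioc 0 1 = Set.Ioc 0 (r ^ 2)⁻¹ := by
    ext t
    constructor
    · rintro ⟨h, h0, h1⟩
      exact ⟨h0, (le_invSqrtSize_iff h0 h1 hr).1 h⟩
    · rintro ⟨h0, h⟩
      exact ⟨(le_invSqrtSize_iff h0 (h.trans h1) hr).2 h, h0, h.trans h1⟩
  rw [e, Real.volume_Ioc, sub_zero]

lemma sizeLaw_lt {r : ℝ} (hr : 1 ≤ r) :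
    sizeLaw {R | r < (R : ℝ)} = ENNReal.ofReal ((r ^ 2)⁻¹) := by
  have hm : MeasurableSet {R : Set.Ici (1 : ℝ) | r < (R : ℝ)} :=
    measurableSet_lt measurable_const measurable_subtype_coe
  have h1 : (r ^ 2)⁻¹ ≤ 1 := inv_le_one_of_one_le₀ (one_le_pow₀ hr)
  rw [sizeLaw, Measure.map_apply measurable_invSqrtSize hm,
    Measure.restrict_apply (measurable_invSqrtSize hm)]
  have e : invSqrtSize ⁻¹' {R | r < (R : ℝ)} ∩ Set.Ioc 0 1 = Set.Ioo 0 (r ^ 2)⁻¹ := by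
    ext t
    constructor
    · rintro ⟨h, h0, h1⟩
      exact ⟨h0, (lt_invSqrtSize_iff h0 h1 hr).1 h⟩
    · rintro ⟨h0, h⟩
      exact ⟨(lt_invSqrtSize_iff h0 (h.le.trans h1) hr).2 h, h0, h.le.trans h1⟩
  rw [e, Real.volume_Ioo, sub_zero]

instance : IsProbabilityMeasure sizeLaw := by
  constructor
  have h := sizeLaw_le le_rfl
  rw [one_pow, inv_one, ENNReal.ofReal_one] at h
  rw [← h]
  congr 1
  ext R
  exact ⟨fun _ => R.2, fun _ => trivial⟩

lemma hasTailDecay_sizeLaw : HasTailDecay sizeLaw 2 := by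
  refine ⟨1, one_pos, fun r hr => ?_⟩
  have e : sizeLaw.real {R | r ≤ (R : ℝ)} = r ^ (-2 : ℝ) := by
    rw [Measure.real, sizeLaw_le hr, ENNReal.toReal_ofReal (by positivity),
      Real.rpow_neg (by linarith)]
    norm_num
  rw [e, inv_one, one_mul]
  exact ⟨le_rfl, le_rfl⟩

/-- Size `1` means slope `0`, a vertical line whose section is a disc without a major direction;
this excludes it almost everywhere. -/
lemma sizeLaw_singleton_one : sizeLaw {⟨1, Set.self_mem_Ici⟩} = 0 := by
  have e : ({⟨1, Set.self_mem_Ici⟩} : Set (Set.Ici (1 : ℝ))) = {R : Set.Ici (1 : ℝ) | 1 < (R : ℝ)}ᶜ := by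
    ext R
    rw [Set.mem_singleton_iff, Set.mem_compl_iff, Set.mem_ofPred_eq, not_lt, Subtype.ext_iff]
    exact ⟨fun h => h.le, fun h => le_antisymm h R.2⟩
  rw [e, prob_compl_eq_zero_iff (measurableSet_lt measurable_const measurable_subtype_coe),
    sizeLaw_lt le_rfl]
  simp

/-! ### The area of an ellipse -/

/-- The centres form an ellipse of the same shape, the preimage of the unit disc under a linear map
of determinant `1/R`. -/
lemma volume_zero_mem_ellipse (R : Set.Ici (1 : ℝ))
    (V : Set.Ioc (-(Real.pi / 2)) (Real.pi / 2)) :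
    volume {z : E2 | (0 : E2) ∈ ellipse (z, (R, V))} = ENNReal.ofReal (R * Real.pi) := by
  have hR : 0 < (R : ℝ) := lt_of_lt_of_le one_pos R.2
  let M : Matrix (Fin 2) (Fin 2) ℝ :=
    !![Real.cos V / R, Real.sin V / R; -Real.sin V, Real.cos V]
  have hdet : LinearMap.det (Matrix.toEuclideanLin M) = (R : ℝ)⁻¹ := by
    rw [Matrix.toEuclideanLin_eq_toLin_orthonormal, LinearMap.det_toLin]
    simp only [M, Matrix.det_fin_two_of]
    field_simp
    linear_combination Real.sin_sq_add_cos_sq V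
  have e : {z : E2 | (0 : E2) ∈ ellipse (z, (R, V))}
      = Matrix.toEuclideanLin M ⁻¹' Metric.closedBall 0 1 := by
    ext z
    rw [Set.mem_preimage, mem_closedBall_zero_iff, ← sq_le_one_iff₀ (norm_nonneg _),
      E2.norm_sq_eq]
    simp only [ellipse, M, Set.mem_ofPred_eq]
    simp [Matrix.toLpLin_apply, dotProduct, Fin.sum_univ_two]
    have e1 : ((-(z 0 * Real.cos V) + -(z 1 * Real.sin V)) / (R : ℝ)) ^ 2
      = (Real.cos V / R * z 0 + Real.sin V / R * z 1) ^ 2 := by ring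
    have e2 : (z 0 * Real.sin V + -(z 1 * Real.cos V)) ^ 2
      = (-(Real.sin V * z 0) + Real.cos V * z 1) ^ 2 := by ring
    rw [e1, e2]
  rw [e, Measure.addHaar_preimage_linearMap _ (by rw [hdet]; positivity), hdet, inv_inv,
    abs_of_pos hR, EuclideanSpace.volume_closedBall_fin_two, ENNReal.ofReal_mul hR.le]
  simp

lemma measurableSet_mem_ellipse (x : E2) : MeasurableSet {s : EllipseParam | x ∈ ellipse s} := by
  simp only [ellipse, Set.mem_ofPred_eq]
  refine measurableSet_le ?_ measurable_const
  have h1 : Measurable fun s : EllipseParam => (s.2.1 : ℝ) :=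
    measurable_subtype_coe.comp (measurable_fst.comp measurable_snd)
  have h2 : Measurable fun s : EllipseParam => (s.2.2 : ℝ) :=
    measurable_subtype_coe.comp (measurable_snd.comp measurable_snd)
  have h3 := h2.cos
  have h4 := h2.sin
  fun_prop

/-- The slope law of an invariant measure gives the law `sizeLaw` to the major semi-axis. -/
lemma IsInvariantLineMeasure.map_slopeSize {μ : Measure Line} (h : IsInvariantLineMeasure μ)
    {σ : Measure E2} [IsFiniteMeasure σ]
    (hσ : μ.map (fun l => (l.trace, l.slope)) = (volume : Measure E2).prod σ) :
    σ.map slopeSize = σ Set.univ • sizeLaw := by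
  have hΨ : Measurable fun l : Line => (l.trace, l.slope) :=
    Line.measurable_trace.prodMk Line.measurable_slope
  have hae : ∀ᵐ l ∂μ, l ∉ horizontalLines :=
    measure_eq_zero_iff_ae_notMem.1 h.measure_horizontalLines
  have hpos : ∀ a, 0 < (slopeSize a : ℝ) := fun a => lt_of_lt_of_le one_pos (slopeSize a).2
  have hshape : Measurable fun p : E2 × E2 =>
      ((p.1, (slopeSize p.2, slopeAngle p.2)) : EllipseParam) :=
    measurable_fst.prodMk ((measurable_slopeSize.comp measurable_snd).prodMk
      (measurable_slopeAngle.comp measurable_snd))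
  let E : Set (E2 × E2) := {p | (0 : E2) ∈ ellipse (p.1, (slopeSize p.2, slopeAngle p.2))}
  have hE : MeasurableSet E := hshape (measurableSet_mem_ellipse 0)
  -- Nearness to the origin means that the ellipse covers the origin; integrating out the trace
  -- leaves the area `πR`.
  have hint : ∀ G : E2 → ℝ≥0∞, Measurable G → ∫⁻ l in Line.near 0, G l.slope ∂μ
      = ∫⁻ a, G a * ENNReal.ofReal (slopeSize a * Real.pi) ∂σ := by
    intro G hG
    have h1 : Line.near 0 =ᵐ[μ] (fun l : Line => (l.trace, l.slope)) ⁻¹' E := by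
      filter_upwards [hae] with l hl
      have := mem_cylinder_iff_mem_ellipse hl 0
      rw [map_zero] at this
      exact propext this
    have hGm : Measurable fun p : E2 × E2 => G p.2 := hG.comp measurable_snd
    rw [setLIntegral_congr h1, ← setLIntegral_map (f := fun p : E2 × E2 => G p.2) hE hGm hΨ, hσ,
      ← lintegral_indicator hE, lintegral_prod_symm _ (hGm.indicator hE).aemeasurable]
    refine lintegral_congr fun a => ?_
    rw [← volume_zero_mem_ellipse (slopeSize a) (slopeAngle a), ← lintegral_indicator_const]
    · rfl
    · exact (hshape.comp measurable_prodMk_right) (measurableSet_mem_ellipse 0)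
  have hS : Measurable fun a => (slopeSize a : ℝ) :=
    measurable_subtype_coe.comp measurable_slopeSize
  -- The cosine weight is `1/R`, which cancels the size-biasing factor `R`.
  have hzone : ∀ r : ℝ, 1 ≤ r → ∫⁻ l in Line.near 0,
      (if Line.cosSq (E3.basisVec 2) l ≤ r⁻¹ ^ 2 then
        ENNReal.ofReal √(Line.cosSq (E3.basisVec 2) l) else 0) ∂μ
      = ENNReal.ofReal Real.pi * σ.map slopeSize {R | r ≤ (R : ℝ)} := by
    intro r hr
    have hr0 : 0 < r := lt_of_lt_of_le one_pos hr
    have hm : MeasurableSet {R : Set.Ici (1 : ℝ) | r ≤ (R : ℝ)} :=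
      measurableSet_le measurable_const measurable_subtype_coe
    have h1 : ∀ᵐ l ∂(μ.restrict (Line.near 0)), (if Line.cosSq (E3.basisVec 2) l ≤ r⁻¹ ^ 2 then
        ENNReal.ofReal √(Line.cosSq (E3.basisVec 2) l) else 0)
        = if r ≤ slopeSize l.slope then ENNReal.ofReal ((slopeSize l.slope : ℝ)⁻¹) else 0 := by
      filter_upwards [ae_restrict_of_ae hae] with l hl
      have i : ((slopeSize l.slope : ℝ) ^ 2)⁻¹ ≤ r⁻¹ ^ 2 ↔ r ≤ slopeSize l.slope := by
        rw [← inv_pow, sq_le_sq₀ (inv_nonneg.2 (hpos _).le) (inv_nonneg.2 hr0.le),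
          inv_le_inv₀ (hpos _) hr0]
      rw [cosSq_eq_inv_sq_slopeSize hl]
      simp only [i]
      rw [← inv_pow, Real.sqrt_sq (inv_nonneg.2 (hpos _).le)]
    rw [lintegral_congr_ae h1, hint (fun a => if r ≤ slopeSize a then
      ENNReal.ofReal ((slopeSize a : ℝ)⁻¹) else 0)
      (Measurable.ite (measurableSet_le measurable_const hS) hS.inv.ennreal_ofReal
        measurable_const), Measure.map_apply measurable_slopeSize hm,
      ← lintegral_indicator_const (measurable_slopeSize hm)]
    refine lintegral_congr fun a => ?_
    simp only [Set.indicator, Set.mem_preimage, Set.mem_ofPred_eq]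
    split_ifs
    · rw [← ENNReal.ofReal_mul (inv_nonneg.2 (hpos a).le), inv_mul_cancel_left₀ (hpos a).ne']
    · rw [zero_mul]
  have huniv : σ.map slopeSize {R | 1 ≤ (R : ℝ)} = σ Set.univ := by
    rw [Measure.map_apply measurable_slopeSize
      (measurableSet_le measurable_const measurable_subtype_coe)]
    congr 1
    ext a
    exact ⟨fun _ => trivial, fun _ => (slopeSize a).2⟩
  have hfin : IsFiniteMeasure (σ.map slopeSize) := inferInstance
  -- Finite measures are compared on half-lines, with `t = 1/R` in the zone formula.
  refine Measure.ext_of_Ici _ _ fun R => ?_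
  have hR : (1 : ℝ) ≤ R := R.2
  have e : Set.Ici R = {R' : Set.Ici (1 : ℝ) | (R : ℝ) ≤ R'} := rfl
  have h1 := h.lintegral_near_zone (t := (R : ℝ)⁻¹) (inv_pos.2 (by linarith))
    (inv_le_one_of_one_le₀ hR)
  have h2 := hzone 1 le_rfl
  rw [inv_one] at h2
  rw [hzone R hR, h2, huniv, mul_left_comm, ENNReal.mul_right_inj
    (by rw [Ne, ENNReal.ofReal_eq_zero, not_le]; exact Real.pi_pos) ENNReal.ofReal_ne_top] at h1
  rw [e, h1, Measure.smul_apply, sizeLaw_le hR, smul_eq_mul, mul_comm, inv_pow]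

/-! ### The law of the direction of the major axis -/

instance fact_two_pi_pos : Fact (0 < 2 * Real.pi) := ⟨Real.two_pi_pos⟩

/-- Twice the direction of the major axis, as an element of the circle `ℝ / 2πℤ`. -/
noncomputable def doubleAngle (a : E2) : AddCircle (2 * Real.pi) :=
  (Complex.arg (slopeComplex a ^ 2) : ℝ)

lemma measurable_doubleAngle : Measurable doubleAngle :=
  AddCircle.measurable_mk'.comp (Complex.measurable_arg.comp (measurable_slopeComplex.pow_const 2))

lemma slopeComplex_planeRotation (θ : ℝ) (a : E2) :
    slopeComplex (planeRotation θ a) = Complex.exp (θ * Complex.I) * slopeComplex a := by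
  apply Complex.ext
  · rw [Complex.mul_re, Complex.exp_ofReal_mul_I_re, Complex.exp_ofReal_mul_I_im]
    simp [slopeComplex, planeRotation]
  · rw [Complex.mul_im, Complex.exp_ofReal_mul_I_re, Complex.exp_ofReal_mul_I_im]
    simp [slopeComplex, planeRotation, add_comm]

/-- Doubling the direction makes it an element of a circle group on which rotations act by
translation, so that uniqueness of Haar measure applies. Slope `0` is excluded because its argument
stays `0` under rotation. -/
lemma doubleAngle_planeRotation {a : E2} (ha : a ≠ 0) (θ : ℝ) :
    doubleAngle (planeRotation θ a) = ((2 * θ : ℝ) : AddCircle (2 * Real.pi)) + doubleAngle a := by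
  have hz : slopeComplex a ^ 2 ≠ 0 := by
    refine pow_ne_zero 2 fun h => ha ?_
    ext i
    fin_cases i
    · exact congrArg Complex.re h
    · exact congrArg Complex.im h
  have he : Complex.exp (θ * Complex.I) ^ 2 = Complex.exp ((2 * θ : ℝ) * Complex.I) := by
    rw [← Complex.exp_nat_mul]
    push_cast
    congr 1
    ring
  have h1 := Complex.arg_mul_coe_angle (Complex.exp_ne_zero ((2 * θ : ℝ) * Complex.I)) hz
  have h2 : ((Complex.arg (Complex.exp ((2 * θ : ℝ) * Complex.I)) : ℝ) : Real.Angle)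
      = ((2 * θ : ℝ) : Real.Angle) := by
    rw [Complex.arg_exp_mul_I, Real.Angle.coe_toIocMod]
  rw [h2] at h1
  rw [doubleAngle, slopeComplex_planeRotation, mul_pow, he]
  exact h1

lemma slopeSize_planeRotation (θ : ℝ) (a : E2) :
    slopeSize (planeRotation θ a) = slopeSize a := by
  rw [slopeSize, slopeSize]
  simp_rw [norm_planeRotation]

/-- Half of the representative in `(-π, π]` of an angle. -/
noncomputable def halfAngle (x : AddCircle (2 * Real.pi)) :
    Set.Ioc (-(Real.pi / 2)) (Real.pi / 2) :=
  ⟨(AddCircle.measurableEquivIoc (2 * Real.pi) (-Real.pi) x : ℝ) / 2, by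
    have h := (AddCircle.measurableEquivIoc (2 * Real.pi) (-Real.pi) x).2
    constructor <;> linarith [h.1, h.2]⟩

lemma measurable_halfAngle : Measurable halfAngle := by
  refine Measurable.subtype_mk (Measurable.div_const ?_ _)
  exact measurable_subtype_coe.comp (AddCircle.measurableEquivIoc _ _).measurable

lemma coe_halfAngle_coe {t : ℝ} (ht : t ∈ Set.Ioc (-Real.pi) Real.pi) :
    (halfAngle (t : AddCircle (2 * Real.pi)) : ℝ) = t / 2 := by
  have e : -Real.pi + 2 * Real.pi = Real.pi := by ring
  have h := AddCircle.equivIoc_coe_of_mem (p := 2 * Real.pi) (a := -Real.pi) (y := t)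
    (by rwa [e])
  exact congrArg (· / 2) h

lemma halfAngle_doubleAngle (a : E2) : halfAngle (doubleAngle a) = slopeAngle a :=
  Subtype.ext (coe_halfAngle_coe (Complex.arg_mem_Ioc _))

/-- Halving doubles the density of Lebesgue measure, and Lebesgue measure on the directions is `π`
times the uniform law. -/
lemma map_halfAngle :
    (volume : Measure (AddCircle (2 * Real.pi))).map halfAngle
      = ENNReal.ofReal (2 * Real.pi) • uniformDirection := by
  have hemb : MeasurableEmbedding
      (Subtype.val : Set.Ioc (-(Real.pi / 2)) (Real.pi / 2) → ℝ) :=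
    MeasurableEmbedding.subtype_coe measurableSet_Ioc
  have e : -Real.pi + 2 * Real.pi = Real.pi := by ring
  ext B hB
  have h1 := (AddCircle.measurePreserving_mk (2 * Real.pi) (-Real.pi)).measure_preimage
    (measurable_halfAngle hB).nullMeasurableSet
  rw [Measure.map_apply measurable_halfAngle hB, ← h1, e,
    Measure.restrict_apply ((AddCircle.measurePreserving_mk (2 * Real.pi) (-Real.pi)).measurable
      (measurable_halfAngle hB)), uniformDirection, Measure.smul_apply, Measure.smul_apply,
    hemb.comap_apply]
  have h2 : (QuotientAddGroup.mk ⁻¹' (halfAngle ⁻¹' B) ∩ Set.Ioc (-Real.pi) Real.pi : Set ℝ)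
      = (fun t => 2⁻¹ * t) ⁻¹' (Subtype.val '' B) := by
    ext t
    constructor
    · rintro ⟨ht, hI⟩
      exact ⟨_, ht, by rw [coe_halfAngle_coe hI]; ring⟩
    · rintro ⟨b, hb, hbt⟩
      have hbt' : (b : ℝ) = 2⁻¹ * t := hbt
      have hI : t ∈ Set.Ioc (-Real.pi) Real.pi := by
        have := b.2
        rw [hbt'] at this
        constructor <;> linarith [this.1, this.2]
      refine ⟨?_, hI⟩
      have : halfAngle (t : AddCircle (2 * Real.pi)) = b :=
        Subtype.ext (by rw [coe_halfAngle_coe hI, hbt']; ring)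
      change halfAngle (t : AddCircle (2 * Real.pi)) ∈ B
      rwa [this]
  rw [h2, Real.volume_preimage_mul_left (by norm_num), smul_eq_mul, smul_eq_mul, ← mul_assoc,
    ENNReal.ofReal_mul zero_le_two, mul_assoc (ENNReal.ofReal 2), ENNReal.mul_inv_cancel
      (by rw [Ne, ENNReal.ofReal_eq_zero, not_le]; exact Real.pi_pos) ENNReal.ofReal_ne_top]
  simp

instance : IsFiniteMeasure uniformDirection := by
  have : IsFiniteMeasure (ENNReal.ofReal (2 * Real.pi) • uniformDirection) := by
    rw [← map_halfAngle]; infer_instance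
  refine ⟨?_⟩
  have h := measure_lt_top (ENNReal.ofReal (2 * Real.pi) • uniformDirection) Set.univ
  rw [Measure.smul_apply, smul_eq_mul] at h
  refine ENNReal.lt_top_of_mul_ne_top_right h.ne ?_
  rw [Ne, ENNReal.ofReal_eq_zero, not_le]
  exact Real.two_pi_pos

/-- The size and the direction of the major axis are independent under a rotation invariant law
of the slope, and the direction is uniform. -/
lemma map_slopeSize_slopeAngle {σ : Measure E2} [IsFiniteMeasure σ]
    (hrot : ∀ θ, σ.map (planeRotation θ) = σ) (hsize : σ.map slopeSize = σ Set.univ • sizeLaw) :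
    σ.map (fun a => (slopeSize a, slopeAngle a))
      = σ Set.univ • sizeLaw.prod uniformDirection := by
  have hf : Measurable fun a => (doubleAngle a, slopeSize a) :=
    measurable_doubleAngle.prodMk measurable_slopeSize
  have h0 : ∀ᵐ a ∂σ, a ≠ 0 := by
    have h1 : σ.map slopeSize {⟨1, Set.self_mem_Ici⟩} = 0 := by
      rw [hsize, Measure.smul_apply, sizeLaw_singleton_one, smul_zero]
    rw [Measure.map_apply measurable_slopeSize (measurableSet_singleton _)] at h1
    filter_upwards [measure_eq_zero_iff_ae_notMem.1 h1] with a ha h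
    refine ha ?_
    subst h
    exact Subtype.ext (by simp [slopeSize])
  set η := σ.map fun a => (doubleAngle a, slopeSize a) with hη
  have hηf : IsFiniteMeasure η := inferInstance
  have hinv : ∀ g : AddCircle (2 * Real.pi), η.map (fun p => (g + p.1, p.2)) = η := by
    intro g
    obtain ⟨t, rfl⟩ := QuotientAddGroup.mk_surjective g
    have hs : Measurable fun p : AddCircle (2 * Real.pi) × Set.Ici (1 : ℝ) =>
        ((t : AddCircle (2 * Real.pi)) + p.1, p.2) :=
      (measurable_fst.const_add _).prodMk measurable_snd
    -- Rotation by `t / 2` translates the doubled angle by `t`.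
    conv_rhs => rw [hη, ← hrot (t / 2), Measure.map_map hf (measurable_planeRotation _)]
    rw [hη]
    refine (Measure.map_map hs hf).trans (Measure.map_congr ?_)
    filter_upwards [h0] with a ha
    simp only [Function.comp]
    rw [doubleAngle_planeRotation ha, slopeSize_planeRotation, mul_div_cancel₀ t two_ne_zero]
  have hK0 : (volume : Measure (AddCircle (2 * Real.pi))) Set.univ ≠ 0 := by
    rw [AddCircle.measure_univ, Ne, ENNReal.ofReal_eq_zero, not_le]
    exact Real.two_pi_pos
  have hprod := eq_prod_of_map_add_left volume isCompact_univ hK0 hinv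
    (fun C _ => measure_lt_top _ _)
  rw [Set.univ_prod_univ, Measure.restrict_univ, AddCircle.measure_univ] at hprod
  have hsnd : η.map Prod.snd = σ Set.univ • sizeLaw := by
    rw [hη, Measure.map_map measurable_snd hf, ← hsize]
    rfl
  rw [hsnd] at hprod
  have hg : Measurable fun p : AddCircle (2 * Real.pi) × Set.Ici (1 : ℝ) =>
      (p.2, halfAngle p.1) := measurable_snd.prodMk (measurable_halfAngle.comp measurable_fst)
  have h2 : σ.map (fun a => (slopeSize a, slopeAngle a))
      = η.map fun p => (p.2, halfAngle p.1) := by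
    rw [hη, Measure.map_map hg hf]
    congr 1
    ext1 a
    simp only [Function.comp, halfAngle_doubleAngle]
  have hS : IsFiniteMeasure (σ Set.univ • sizeLaw) := Measure.smul_finite _ (measure_ne_top _ _)
  have hS' : IsFiniteMeasure ((ENNReal.ofReal (2 * Real.pi))⁻¹ • σ Set.univ • sizeLaw) :=
    Measure.smul_finite _ (ENNReal.inv_ne_top.2
      (by rw [Ne, ENNReal.ofReal_eq_zero, not_le]; exact Real.two_pi_pos))
  have hg' : (fun p : AddCircle (2 * Real.pi) × Set.Ici (1 : ℝ) => (p.2, halfAngle p.1))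
      = Prod.map id halfAngle ∘ Prod.swap := rfl
  rw [h2, hprod, hg', ← Measure.map_map (measurable_id.prodMap measurable_halfAngle)
    measurable_swap, Measure.prod_swap, ← Measure.map_prod_map _ _ measurable_id
    measurable_halfAngle, Measure.map_id, map_halfAngle, Measure.prod_smul_right,
    Measure.prod_smul_left, Measure.prod_smul_left, smul_smul, ENNReal.mul_inv_cancel
      (by rw [Ne, ENNReal.ofReal_eq_zero, not_le]; exact Real.two_pi_pos) ENNReal.ofReal_ne_top,
    one_smul]

/-! ### Images of Poisson processes -/

lemma IsPointMeasure.map {X Y : Type*} [MeasurableSpace X] [MeasurableSpace Y] {m : Measure X}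
    (hm : IsPointMeasure m) {T : X → Y} (hT : Measurable T) : IsPointMeasure (m.map T) := by
  obtain ⟨I, hI, x, rfl⟩ := hm
  refine ⟨I, hI, fun i => T (x i), ?_⟩
  rw [Measure.map_sum hT.aemeasurable]
  congr 1
  ext1 i
  exact Measure.map_dirac' hT _

/-- Every clause for a set `A` is the clause of `N` for `T ⁻¹' A`; sets of infinite intensity have
their own clause, so `T` only has to be measurable. -/
lemma IsPoissonProcess.map {X Y Ω : Type*} [MeasurableSpace X] [MeasurableSpace Y]
    [MeasurableSpace Ω] {P : Measure Ω} {N : Ω → Measure X} {Λ : Measure X}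
    (h : IsPoissonProcess P N Λ) {T : X → Y} (hT : Measurable T) :
    IsPoissonProcess P (fun ω => (N ω).map T) (Λ.map T) where
  measurable_count A hA := by
    simp_rw [Measure.map_apply hT hA]
    exact h.measurable_count _ (hT hA)
  isPointMeasure := h.isPointMeasure.mono fun ω hω => hω.map hT
  law_count A hA hΛ := by
    rw [Measure.map_apply hT hA] at hΛ ⊢
    simp_rw [Measure.map_apply hT hA]
    exact h.law_count _ (hT hA) hΛ
  count_eq_top A hA hΛ := by
    rw [Measure.map_apply hT hA] at hΛ
    simp_rw [Measure.map_apply hT hA]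
    exact h.count_eq_top _ (hT hA) hΛ
  indep n A hA hd := by
    have h1 : (fun i ω => (N ω).map T (A i)) = fun i ω => N ω (T ⁻¹' A i) := by
      ext i ω
      exact Measure.map_apply hT (hA i)
    rw [h1]
    exact h.indep n _ (fun i => hT (hA i)) fun i j hij => (hd hij).preimage T

/-- A Poisson process has no point in a set of intensity `0`. -/
lemma IsPoissonProcess.ae_eq_zero {X Ω : Type*} [MeasurableSpace X]
    [MeasurableSpace Ω] {P : Measure Ω} {N : Ω → Measure X} {Λ : Measure X}
    (h : IsPoissonProcess P N Λ) {A : Set X} (hA : MeasurableSet A) (h0 : Λ A = 0) :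
    ∀ᵐ ω ∂P, N ω A = 0 := by
  have h1 := h.law_count A hA (by rw [h0]; exact ENNReal.zero_ne_top)
  have h2 : (P.map fun ω => N ω A) {0}ᶜ = 0 := by
    rw [h1, Measure.map_apply (measurable_of_countable _) (measurableSet_singleton _).compl, h0,
      ENNReal.toNNReal_zero]
    have e : (fun k : ℕ => (k : ℝ≥0∞)) ⁻¹' {0}ᶜ = {0}ᶜ := by
      ext k
      simp
    rw [e, prob_compl_eq_zero_iff (measurableSet_singleton 0), poissonMeasure_singleton]
    simp
  rw [Measure.map_apply (h.measurable_count A hA) (measurableSet_singleton _).compl] at h2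
  exact h2

/-- The points of the image of a point measure. -/
lemma IsPointMeasure.points_map {X Y : Type*} [MeasurableSpace X] [MeasurableSpace Y]
    [MeasurableSingletonClass Y] {m : Measure X}
    (hm : IsPointMeasure m) {T : X → Y} (hT : Measurable T) :
    points (m.map T) = T '' points m := by
  obtain ⟨I, hI, x, rfl⟩ := hm
  ext s
  simp only [points, Set.mem_ofPred_eq, Set.mem_image]
  rw [Measure.map_apply hT (measurableSet_singleton s)]
  constructor
  · intro hs
    rw [Measure.sum_apply _ (hT (measurableSet_singleton s)), Ne, ENNReal.tsum_eq_zero,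
      not_forall] at hs
    obtain ⟨i, hi⟩ := hs
    refine ⟨x i, fun h0 => ?_, ?_⟩
    -- Singletons of `X` are not assumed measurable, so only the inequality `1 ≤ dirac (x i) {x i}`
    -- is used.
    · have h1 := (Measure.le_sum (fun i => Measure.dirac (x i)) i {x i}).trans_eq h0
      have h2 := Measure.le_dirac_apply (a := x i) (s := {x i})
      rw [Set.indicator_of_mem (Set.mem_singleton _)] at h2
      exact absurd (h2.trans h1) (by simp)
    · by_contra h
      refine hi ?_
      rw [Measure.dirac_apply' _ (hT (measurableSet_singleton s)), Set.indicator_of_notMem]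
      exact h
  · rintro ⟨l, hl, rfl⟩ h0
    exact hl (measure_mono_null (by simp) h0)

/-! ### The sections of the Poisson cylinder model -/

/-- The image of an invariant measure on the space of lines under the horizontal section. -/
lemma IsInvariantLineMeasure.exists_map_horizontalSection {μ : Measure Line}
    (h : IsInvariantLineMeasure μ) :
    ∃ c : ℝ, 0 < c ∧ μ.map horizontalSection = ellipsesIntensity c sizeLaw := by
  obtain ⟨σ, hσf, hσ, hrot⟩ := h.exists_slope_law
  have hΨ : Measurable fun l : Line => (l.trace, l.slope) :=
    Line.measurable_trace.prodMk Line.measurable_slope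
  have h0 : σ Set.univ ≠ 0 := by
    intro h0
    rw [Measure.measure_univ_eq_zero.1 h0, Measure.prod_zero] at hσ
    exact h.ne_zero ((Measure.map_eq_zero_iff hΨ.aemeasurable).1 hσ)
  have hshape : Measurable fun a => (slopeSize a, slopeAngle a) :=
    measurable_slopeSize.prodMk measurable_slopeAngle
  -- The constant `c` is the total mass of the slope law; it is nonzero since otherwise `μ` would
  -- vanish.
  refine ⟨(σ Set.univ).toReal, ENNReal.toReal_pos h0 (measure_ne_top _ _), ?_⟩
  have e : horizontalSection = Prod.map id (fun a => (slopeSize a, slopeAngle a)) ∘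
      fun l : Line => (l.trace, l.slope) := rfl
  rw [e, ← Measure.map_map (measurable_id.prodMap hshape) hΨ, hσ,
    ← Measure.map_prod_map _ _ measurable_id hshape, Measure.map_id,
    map_slopeSize_slopeAngle hrot (h.map_slopeSize hσ), ellipsesIntensity,
    ENNReal.ofReal_toReal (measure_ne_top _ _), Measure.prod_smul_right, Measure.prod_smul_left]

lemma smul_ellipsesIntensity {c u : ℝ} (hc : 0 ≤ c) (ρ : Measure (Set.Ici (1 : ℝ))) [SFinite ρ] :
    ENNReal.ofReal u • ellipsesIntensity c ρ = ellipsesIntensity (c * u) ρ := by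
  rw [ellipsesIntensity, ellipsesIntensity, Measure.prod_smul_left, Measure.prod_smul_left,
    smul_smul, ENNReal.ofReal_mul hc, mul_comm]

end PoissonEllipses

open PoissonEllipses
theorem mainTheorem9 :
    ∃ ρ : Measure (Set.Ici (1 : ℝ)), IsProbabilityMeasure ρ ∧
      (∀ r : ℝ, 1 ≤ r → ρ {R | r < (R : ℝ)} = ENNReal.ofReal (r ^ (-2 : ℤ))) ∧
      ∀ μ : Measure Line, IsInvariantLineMeasure μ → ∃ c : ℝ, 0 < c ∧
        -- `ι` is an isometric parametrization of an arbitrary plane in `ℝ³`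
        ∀ ι : E2 →ᵃⁱ[ℝ] E3, ∃ T : Line → EllipseParam, Measurable T ∧
          (∀ l : Line, ¬ l.carrier.direction ≤ LinearMap.range ι.linear →
            ι ⁻¹' l.cylinder = ellipse (T l)) ∧
          ∀ (Ω : Type*) [MeasurableSpace Ω] (P : Measure Ω) [IsProbabilityMeasure P]
            (u : ℝ) (N : Ω → Measure Line), IsCylinderModel P N u μ →
            IsEllipsesModel P (fun ω => (N ω).map T) (c * u) ρ ∧
            ∀ᵐ ω ∂P,
              (∀ l ∈ points (N ω), ι ⁻¹' l.cylinder = ellipse (T l)) ∧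
              ι ⁻¹' cylindersCoveredSet (N ω) = ellipsesCoveredSet ((N ω).map T) := by
  refine ⟨sizeLaw, inferInstance, fun r hr => ?_, fun μ hμ => ?_⟩
  · rw [sizeLaw_lt hr, zpow_neg]
    norm_cast
  obtain ⟨c, hc, hmap⟩ := hμ.exists_map_horizontalSection
  refine ⟨c, hc, fun ι => ?_⟩
  obtain ⟨f, hf, hfL, hfμ⟩ := exists_isometry_comp_horizontal ι
  have hfm := Line.measurable_map f.symm
  have hT : Measurable (horizontalSection ∘ Line.map f.symm) :=
    measurable_horizontalSection.comp hfm
  have hsec : ∀ l : Line, Line.map f.symm l ∉ horizontalLines →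
      ι ⁻¹' l.cylinder = ellipse ((horizontalSection ∘ Line.map f.symm) l) := by
    intro l hl
    ext x
    rw [Function.comp, ← mem_cylinder_iff_mem_ellipse hl, Set.mem_preimage, ← hf,
      ← Line.mem_cylinder_map (f := f.symm), f.symm_apply_apply]
  refine ⟨_, hT, fun l hl => hsec l fun hl' => hl ?_, ?_⟩
  · have h1 := direction_le_of_mem_horizontalLines hl'
    intro v hv
    have hv' : f.symm.linearIsometryEquiv v ∈ (Line.map f.symm l).carrier.direction := by
      change _ ∈ (l.carrier.map _).direction
      rw [AffineSubspace.map_direction]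
      exact ⟨v, hv, rfl⟩
    obtain ⟨w, hw⟩ := h1 hv'
    refine ⟨w, ?_⟩
    rw [← hfL]
    change f.linearIsometryEquiv (horizontal.toLinearMap w) = v
    rw [hw]
    exact f.linearIsometryEquiv.apply_symm_apply v
  · intro Ω _ P _ u N hN
    have hP := hN.isPoissonProcess
    have hint : (ENNReal.ofReal u • μ).map (horizontalSection ∘ Line.map f.symm)
        = ellipsesIntensity (c * u) sizeLaw := by
      rw [Measure.map_smul, ← Measure.map_map measurable_horizontalSection hfm, hfμ μ hμ, hmap,
        smul_ellipsesIntensity hc.le]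
    refine ⟨⟨mul_pos hc hN.intensity_pos, inferInstance, ⟨2, two_pos, hasTailDecay_sizeLaw⟩,
      hint ▸ hP.map hT⟩, ?_⟩
    -- The lines parallel to the plane are `μ`-null, so almost surely the process has none and the
    -- section formula holds for all its lines at once.
    have hpar : μ (Line.map f.symm ⁻¹' horizontalLines) = 0 := by
      rw [← Measure.map_apply hfm measurableSet_horizontalLines, hfμ μ hμ,
        hμ.measure_horizontalLines]
    have h0 := hP.ae_eq_zero (hfm measurableSet_horizontalLines)
      (by rw [Measure.smul_apply, hpar, smul_zero])
    filter_upwards [h0, hP.isPointMeasure] with ω hω hpt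
    have h1 : ∀ l ∈ points (N ω),
        ι ⁻¹' l.cylinder = ellipse ((horizontalSection ∘ Line.map f.symm) l) := by
      intro l hl
      refine hsec l fun hl' => hl (measure_mono_null ?_ hω)
      exact Set.singleton_subset_iff.2 hl'
    refine ⟨h1, ?_⟩
    rw [cylindersCoveredSet, ellipsesCoveredSet, hpt.points_map hT, Set.preimage_iUnion₂,
      Set.biUnion_image]
    exact Set.iUnion₂_congr h1
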